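/- Let $\sigma>0$ and let $\mathcal B_\sigma=\{f\in L^2(\mathbb R):\operatorname{supp}\widehat f\subseteq[-\tfrac{\sigma}{2\pi},\tfrac{\sigma}{2\pi}]\}$, where $\widehat f(w)=\int_{\mathbb R}f(x)e^{-2\pi ixw}\,dx$; every $f\in\mathcal B_\sigma$ is identified with its smooth representative. For an integer $k\ge1$ let $c_k$ be the smallest eigenvalue $\lambda$ of the boundary value problem $$(-1)^k u^{(2k)}=\lambda u\ \text{ on }[0,1],\qquad u^{(l)}(0)=u^{(l)}(1)=0,\quad 0\le l\le k-1,\qquad u\in C^{2k}[0,1].$$ **Theorem.** Let $k\ge 1$, and let $\{x_i\}_{i\in\mathbb Z}$ be a strictly increasing sequence of real numbers which is separated by a constant $\gamma>0$, i.e. $|x_i-x_j|\ge\gamma$ for all $i\ne j$. If for some integer $\nu\ge1$ $$\delta_\nu:=\sup_{i\in\mathbb Z}(x_{i+\nu}-x_i)<\frac{\nu}{\sigma}\,c_k^{1/2k},$$ then there exist constants $A,B>0$ such that $$A\,\|f\|_2^2\le\sum_{i\in\mathbb Z}\sum_{l=0}^{k-1}|f^{(l)}(x_i)|^2\le B\,\|f\|_2^2\qquad\text{for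 every }f\in\mathcal B_\sigma .$$ -/

import Mathlib

open MeasureTheory
open scoped FourierTransform ContDiff

/-- The bi-infinite sequence `x` is separated by the constant `γ`. -/
def SeparatedBy (x : ℤ → ℝ) (γ : ℝ) : Prop :=
  ∀ i j : ℤ, i ≠ j → γ ≤ |x i - x j|

/-- The space of `σ`-bandlimited functions: the classes `f` in `L²(ℝ)` whose (Plancherel) Fourier
transform, normalized by the kernel `exp (-2πixw)`, is supported in `[-σ/(2π), σ/(2π)]`. As the
interval is closed, this says that the transform vanishes almost everywhere off it. -/
def Bandlimited (σ : ℝ) : Set (Lp ℂ 2 (volume : Measure ℝ)) :=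
  {f | ∀ᵐ w : ℝ, w ∉ Set.Icc (-(σ / (2 * Real.pi))) (σ / (2 * Real.pi)) → (𝓕 f) w = 0}

/-- `lam` is an eigenvalue of the problem `(-1)^r u^(2r) = lam * u` on `[0,1]`, with
`u^(l)(0) = u^(l)(1) = 0` for `0 ≤ l ≤ r - 1`, where `u` is of class `C^{2r}` on `[0,1]` and not
identically zero there (derivatives at the end points are one-sided). The problem is self-adjoint
with real coefficients, so real `lam` and real-valued `u` suffice. -/
def IsWirtingerEigenvalue (r : ℕ) (lam : ℝ) : Prop :=
  ∃ u : ℝ → ℝ,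
    ContDiffOn ℝ (2 * r : ℕ) u (Set.Icc 0 1) ∧
    (∃ t ∈ Set.Icc (0 : ℝ) 1, u t ≠ 0) ∧
    (∀ t ∈ Set.Icc (0 : ℝ) 1,
      (-1) ^ r * iteratedDerivWithin (2 * r) u (Set.Icc 0 1) t = lam * u t) ∧
    (∀ l < r, iteratedDerivWithin l u (Set.Icc 0 1) 0 = 0 ∧
      iteratedDerivWithin l u (Set.Icc 0 1) 1 = 0)

/-- The Wirtinger-Sobolev constant `c_r`: the smallest eigenvalue of the above problem. For
`1 ≤ r` the eigenvalues form a nonempty discrete set of positive reals, so that the infimum is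
the minimum. -/
noncomputable def wirtingerConst (r : ℕ) : ℝ :=
  sInf {lam : ℝ | IsWirtingerEigenvalue r lam}

/-! The constant `c_k` matters only through the bound `c_k ^ (1 / 2k) ≤ k π`
(`wirtingerConst_rpow_le`). The hypothesis therefore forces `σ δ / ν < k π`: counted `k` times each,
the nodes have density greater than `σ / π`, the critical density for functions of exponential type
`σ`. Sampling above that density is a theorem of Beurling type with multiplicities.

The bound on `c_k` is a Rayleigh quotient estimate for `s t = sin (π t) ^ k`, which vanishes to
order `k` at `0` and `1`. Its frequencies lie in `[-k π, k π]`, so Parseval gives `∫ (s^(k))² ≤ (k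
π)^(2k) ∫ s²`. That such a quotient dominates an eigenvalue is
`exists_isWirtingerEigenvalue_mul_le`: with `V` the Volterra operator and `P` the projection
orthogonal to the polynomials of degree less than `k`, the boundary value problem becomes the
eigenvalue problem of the compact positive operator `P V*^k V^k P`.

For sampling, Jensen's formula shows that a function of type `τ`, bounded on the line, cannot have
too many zeros of order `k` without vanishing at `0` (`eq_zero_of_dense_zeros`). Normal families
make this quantitative, uniformly in the nodes (`exists_uniform_sample_lower_bound`). Translating to
a point where `|f|` is nearly maximal yields sampling in the supremum norm
(`exists_norm_le_mul_of_samples`). To reach `L²`, this is applied to `Φ(z) Ψ(z - y)`, where `Ψ` is a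
sinc function of type `ε` with `Ψ(0) = 1` and `ε` uses up part of the slack in the density
inequality; the squared bound for `Φ(y)` is then integrated over `y`
(`integral_norm_sq_bandExt_le_tsum`). The upper frame bound is a Sobolev inequality on disjoint
intervals at the nodes combined with Bernstein's inequality. -/

/-! ### Jensen's formula and uniqueness from dense zeros of order `k`. -/

theorem integral_sin_zero_pi_eq : ∫ θ in (0:ℝ)..Real.pi, Real.sin θ = 2 := by
  rw [integral_sin]; norm_num

/-- The mean of `τ |Im z|` over a circle about the origin. -/
theorem circleAverage_mul_abs_im (τ : ℝ) {R : ℝ} (hR : 0 < R) :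
    Real.circleAverage (fun z : ℂ => τ * |z.im|) 0 R = 2 * τ * R / Real.pi := by
  have hs : ∀ a b : ℝ, IntervalIntegrable (fun θ : ℝ => |Real.sin θ|) volume a b := fun a b =>
    (Real.continuous_sin.abs).intervalIntegrable a b
  have e1 : ∫ θ in (0:ℝ)..Real.pi, |Real.sin θ| = 2 := by
    rw [← integral_sin_zero_pi_eq]
    refine intervalIntegral.integral_congr fun θ hθ => ?_
    rw [Set.uIcc_of_le Real.pi_pos.le] at hθ
    exact abs_of_nonneg (Real.sin_nonneg_of_mem_Icc hθ)
  have e2 : ∫ θ in Real.pi..(2 * Real.pi), |Real.sin θ| = 2 := by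
    have := intervalIntegral.integral_comp_add_right (a := 0) (b := Real.pi)
      (fun θ => |Real.sin θ|) Real.pi
    simp only [Real.sin_add_pi, abs_neg, zero_add, ← two_mul] at this
    rw [← this, e1]
  have e3 : ∫ θ in (0:ℝ)..(2 * Real.pi), |Real.sin θ| = 4 := by
    rw [← intervalIntegral.integral_add_adjacent_intervals (hs 0 Real.pi) (hs _ _), e1, e2]
    norm_num
  have e4 : ∀ θ : ℝ, τ * |(circleMap 0 R θ).im| = τ * R * |Real.sin θ| := by
    intro θ
    have : (circleMap 0 R θ).im = R * Real.sin θ := by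
      simp [circleMap, Complex.exp_im]
    rw [this, abs_mul, abs_of_pos hR, mul_assoc]
  rw [Real.circleAverage_def]
  simp only [e4, intervalIntegral.integral_const_mul, e3, smul_eq_mul]
  field_simp
  ring

/-- Jensen's inequality for entire functions of exponential type `τ` bounded by `1` on the real
line, keeping only zeros of order at least `k`. -/
theorem sum_log_le_of_exponential_type {k : ℕ} {τ : ℝ} (hτ : 0 ≤ τ) {f : ℂ → ℂ}
    (hf : Differentiable ℂ f) (hgrowth : ∀ z, ‖f z‖ ≤ Real.exp (τ * |z.im|)) (h0 : f 0 ≠ 0)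
    {R : ℝ} (hR : 0 < R) (S : Finset ℂ) (hS : ∀ u ∈ S, ‖u‖ ≤ R)
    (hz : ∀ u ∈ S, ∀ l < k, iteratedDeriv l f u = 0) :
    ∑ u ∈ S, (k : ℝ) * Real.log (R / ‖u‖) + Real.log ‖f 0‖ ≤ 2 * τ * R / Real.pi := by
  have han : AnalyticOnNhd ℂ f Set.univ := hf.differentiableOn.analyticOnNhd isOpen_univ
  have hj := (han.mono (Set.subset_univ (Metric.closedBall (0:ℂ) |R|))).circleAverage_log_norm
    hR.ne' h0
  have hmean : Real.circleAverage (fun z => Real.log ‖f z‖) 0 R ≤ 2 * τ * R / Real.pi := by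
    rw [← circleAverage_mul_abs_im τ hR]
    refine Real.circleAverage_mono ?_ ?_ ?_
    · exact (han.mono (Set.subset_univ _)).meromorphicOn.circleIntegrable_log_norm
    · refine ContinuousOn.circleIntegrable hR.le ?_
      fun_prop
    · intro z _
      -- At a zero on the circle `Real.log 0 = 0`, so the bound there is just `0 ≤ τ |Im z|`.
      by_cases h : f z = 0
      · simp only [h, norm_zero, Real.log_zero]; positivity
      · exact (Real.log_le_iff_le_exp (norm_pos_iff.2 h)).2 (hgrowth z)
  refine le_trans ?_ hmean
  rw [hj]
  gcongr
  set D := MeromorphicOn.divisor f (Metric.closedBall (0:ℂ) |R|) with hD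
  have hfin := D.finiteSupport (isCompact_closedBall (0:ℂ) |R|)
  have hDapp : ∀ u ∈ Metric.closedBall (0:ℂ) |R|, D u = ((analyticOrderAt f u).map (↑)).untop₀ :=
    fun u hu => MeromorphicOn.AnalyticOnNhd.divisor_apply (han.mono (Set.subset_univ _)) hu
  -- Every term of Jensen's sum is nonnegative, so discarding the zeros outside `S` only lowers it.
  have hnn : ∀ u, 0 ≤ (D u : ℝ) * Real.log (R * ‖0 - u‖⁻¹) := by
    intro u
    by_cases hu : u ∈ Metric.closedBall (0:ℂ) |R|
    · refine mul_nonneg ?_ ?_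
      · rw [hDapp u hu]
        cases h : analyticOrderAt f u <;> simp
      · rw [zero_sub, norm_neg]
        by_cases hu0 : u = 0
        · simp [hu0]
        · refine Real.log_nonneg ?_
          rw [← div_eq_mul_inv, one_le_div (norm_pos_iff.2 hu0)]
          simpa [abs_of_pos hR] using hu
    · rw [Function.locallyFinsuppWithin.apply_eq_zero_of_notMem _ hu]; simp
  have hsupp : (Function.support fun u => (D u : ℝ) * Real.log (R * ‖0 - u‖⁻¹)) ⊆
      ((S ∪ hfin.toFinset : Finset ℂ) : Set ℂ) := by
    intro u hu
    have : D u ≠ 0 := by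
      intro h; simp [h] at hu
    simp only [Finset.coe_union, Set.Finite.coe_toFinset]
    right; exact this
  rw [finsum_eq_sum_of_support_subset _ hsupp]
  refine le_trans (Finset.sum_le_sum fun u hu => ?_)
    (Finset.sum_le_sum_of_subset_of_nonneg Finset.subset_union_left fun u _ _ => hnn u)
  have hub : u ∈ Metric.closedBall (0:ℂ) |R| := by simpa [abs_of_pos hR] using hS u hu
  rw [zero_sub, norm_neg, ← div_eq_mul_inv]
  by_cases hu0 : u = 0
  · simp [hu0]
  refine mul_le_mul_of_nonneg_right ?_ (Real.log_nonneg ?_)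
  · have hord : (k : ℕ∞) ≤ analyticOrderAt f u :=
      (natCast_le_analyticOrderAt_iff_iteratedDeriv_eq_zero (han u trivial)).2 (hz u hu)
    -- `untop₀` would send infinite order to `0`; the identity theorem and `f 0 ≠ 0` exclude it.
    have htop : analyticOrderAt f u ≠ ⊤ := by
      intro h
      rw [analyticOrderAt_eq_top] at h
      have := han.eqOn_zero_of_preconnected_of_eventuallyEq_zero isPreconnected_univ trivial h
      exact h0 (this trivial)
    rw [hDapp u hub]
    obtain ⟨n, hn⟩ := ENat.ne_top_iff_exists.1 htop
    rw [← hn] at hord ⊢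
    have : k ≤ n := by exact_mod_cast hord
    simpa using this
  · rw [one_le_div (norm_pos_iff.2 hu0)]; exact hS u hu

/-- A lower Stirling-type bound. -/
theorem sub_log_le_sum_log {M : ℝ} (hM : 1 ≤ M) (N : ℕ) :
    N - (M + 1) * (Real.log (M + N) - Real.log M) ≤
      ∑ i ∈ Finset.range N, Real.log ((M + N) / (M + (i + 1))) := by
  have key : ∀ x : ℝ, 0 < x → 1 / (x + 1) ≤ Real.log (x + 1) - Real.log x := by
    intro x hx
    have := Real.one_sub_inv_le_log_of_pos (show 0 < (x + 1) / x by positivity)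
    rw [Real.log_div (by positivity) hx.ne'] at this
    refine le_trans (le_of_eq ?_) this
    field_simp; ring
  have hform : ∀ N : ℕ, ∑ i ∈ Finset.range N, Real.log ((M + N) / (M + (i + 1))) =
      N * Real.log (M + N) - ∑ i ∈ Finset.range N, Real.log (M + (i + 1)) := by
    intro N
    rw [← nsmul_eq_mul, ← Finset.card_range N, ← Finset.sum_const, Finset.card_range,
      ← Finset.sum_sub_distrib]
    refine Finset.sum_congr rfl fun i _ => ?_
    rw [Real.log_div (by positivity) (by positivity)]
  rw [hform]
  induction N with
  | zero => simp
  | succ N ih =>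
    rw [Finset.sum_range_succ]
    push_cast
    have hx : 0 < M + N := by positivity
    -- With `L = log (M + N + 1) - log (M + N)`, the step to `N + 1` adds `1 - (M + 1) L` on the
    -- left and `N L` on the right, the new summand being `log 1`. So it suffices that `1 ≤ (M + N +
    -- 1) L`.
    have h := key (M + N) hx
    have h2 : 1 = (M + 1) * (1 / (M + N + 1)) + N * (1 / (M + N + 1)) := by
      field_simp; ring
    have h3 := mul_le_mul_of_nonneg_left h (show 0 ≤ M + 1 by positivity)
    have h4 := mul_le_mul_of_nonneg_left h (show (0:ℝ) ≤ N by positivity)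
    rw [← add_assoc]
    nlinarith [h3, h4, ih, h2]

/-- An entire function of exponential type `τ`, bounded on the real line, is determined by its
derivatives of order less than `k` at a set of density greater than `τ / (k π)`. -/
theorem eq_zero_of_dense_zeros {k : ℕ} {τ d C : ℝ} (hτ : 0 ≤ τ) (hd : 0 < d)
    (hτd : τ * d < k * Real.pi) {f : ℂ → ℂ}
    (hf : Differentiable ℂ f) (hgrowth : ∀ z, ‖f z‖ ≤ Real.exp (τ * |z.im|))
    (X : ℤ → ℝ) (hX : Function.Injective X) (hXb : ∀ i, |X i| ≤ C + d * |(i : ℝ)|)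
    (hz : ∀ i, ∀ l < k, iteratedDeriv l f (X i : ℂ) = 0) : f 0 = 0 := by
  by_contra h0
  have hk : 0 < k := by
    rcases Nat.eq_zero_or_pos k with h | h
    · subst h
      have := mul_nonneg hτ hd.le
      simp at hτd; linarith
    · exact h
  have hXne : ∀ i, X i ≠ 0 := by
    intro i hi
    have := hz i 0 hk
    rw [hi] at this
    exact h0 (by simpa using this)
  obtain ⟨M, hM1, hMC⟩ : ∃ M : ℝ, 1 ≤ M ∧ C ≤ d * M :=
    ⟨max 1 (C / d), le_max_left _ _, by
      rw [← div_le_iff₀' hd]; exact le_max_right _ _⟩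
  -- Jensen on the disc of radius `d (M + N)`, which contains the nodes of index `±1, …, ±N`: `2 N`
  -- zeros of order at least `k`.
  have main : ∀ N : ℕ, 2 * (k * (N - (M + 1) * (Real.log (M + N) - Real.log M))) +
      Real.log ‖f 0‖ ≤ 2 * τ * (d * (M + N)) / Real.pi := by
    intro N
    set R := d * (M + N) with hR
    have hRpos : 0 < R := by positivity
    let Y : ℕ ⊕ ℕ → ℤ := Sum.elim (fun i => (i : ℤ) + 1) (fun i => -((i : ℤ) + 1))
    have hY : Function.Injective Y := by
      rintro (a | a) (b | b) h <;> simp only [Y, Sum.elim_inl, Sum.elim_inr] at h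
      · congr 1; omega
      · omega
      · omega
      · congr 1; omega
    let T := (Finset.range N).disjSum (Finset.range N)
    let Z : ℕ ⊕ ℕ → ℂ := fun s => ((X (Y s) : ℝ) : ℂ)
    have hZ : Function.Injective Z := fun a b h => hY (hX (Complex.ofReal_injective h))
    have hZn : ∀ s, ‖Z s‖ = |X (Y s)| := fun s => by simp [Z]
    have hYabs : ∀ i : ℕ, |((Y (Sum.inl i) : ℤ) : ℝ)| = i + 1 ∧
        |((Y (Sum.inr i) : ℤ) : ℝ)| = i + 1 := by
      intro i
      have : (0:ℝ) ≤ (i:ℝ) + 1 := by positivity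
      constructor
      · simp [Y, abs_of_nonneg this]
      · simp only [Y, Sum.elim_inr]; push_cast; rw [abs_neg, abs_of_nonneg this]
    have hle : ∀ s ∈ T, ∀ i : ℕ, |((Y s : ℤ) : ℝ)| = i + 1 → i < N →
        ‖Z s‖ ≤ R ∧ (k : ℝ) * Real.log ((M + N) / (M + (i + 1))) ≤ k * Real.log (R / ‖Z s‖) := by
      intro s _ i hi hiN
      have h1 : ‖Z s‖ ≤ d * (M + (i + 1)) := by
        rw [hZn]; refine (hXb _).trans ?_
        rw [hi]; linarith
      have hp : 0 < ‖Z s‖ := by rw [hZn]; exact abs_pos.2 (hXne _)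
      have hiN' : (i:ℝ) + 1 ≤ N := by exact_mod_cast hiN
      refine ⟨h1.trans ?_, ?_⟩
      · rw [hR]; gcongr
      · refine mul_le_mul_of_nonneg_left (Real.log_le_log (by positivity) ?_) (by positivity)
        rw [div_le_div_iff₀ (by positivity) hp, hR]
        have : (0:ℝ) ≤ M + N := by positivity
        nlinarith
    have hall : ∀ s ∈ T, ∃ i : ℕ, |((Y s : ℤ) : ℝ)| = i + 1 ∧ i < N := by
      rintro (i | i) hs
      · exact ⟨i, (hYabs i).1, by simpa [T] using hs⟩
      · exact ⟨i, (hYabs i).2, by simpa [T] using hs⟩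
    have hj := sum_log_le_of_exponential_type (k := k) hτ hf hgrowth h0 hRpos
      (T.map ⟨Z, hZ⟩)
      (by
        intro u hu
        obtain ⟨s, hs, rfl⟩ := Finset.mem_map.1 hu
        obtain ⟨i, hi, hiN⟩ := hall s hs
        exact (hle s hs i hi hiN).1)
      (by
        intro u hu l hl
        obtain ⟨s, hs, rfl⟩ := Finset.mem_map.1 hu
        exact hz _ l hl)
    refine le_trans ?_ hj
    gcongr
    rw [Finset.sum_map]
    simp only [Function.Embedding.coeFn_mk]
    have hst := sub_log_le_sum_log hM1 N
    have hk' : (0:ℝ) ≤ k := by positivity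
    have e : ∑ s ∈ T, (k : ℝ) * Real.log (R / ‖Z s‖) =
        ∑ i ∈ Finset.range N, (k : ℝ) * Real.log (R / ‖Z (Sum.inl i)‖) +
        ∑ i ∈ Finset.range N, (k : ℝ) * Real.log (R / ‖Z (Sum.inr i)‖) :=
      Finset.sum_disjSum _ _ _
    rw [e, two_mul]
    have hst' := mul_le_mul_of_nonneg_left hst hk'
    rw [Finset.mul_sum] at hst'
    refine add_le_add (hst'.trans (Finset.sum_le_sum fun i hi => ?_))
      (hst'.trans (Finset.sum_le_sum fun i hi => ?_))
    · exact (hle (Sum.inl i) (by simpa [T] using hi) i (hYabs i).1 (Finset.mem_range.1 hi)).2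
    · exact (hle (Sum.inr i) (by simpa [T] using hi) i (hYabs i).2 (Finset.mem_range.1 hi)).2
  -- divide by `N` and let `N` tend to infinity
  set a : ℝ := 2 * k - 2 * τ * d / Real.pi with ha
  have hapos : 0 < a := by
    rw [ha, sub_pos, div_lt_iff₀ Real.pi_pos]; linarith
  set b : ℝ := 2 * k * (M + 1) with hb
  have hbpos : 0 < b := by positivity
  have hlo := (Real.isLittleO_log_id_atTop).bound (show 0 < a / (2 * b) by positivity)
  set K : ℝ := 2 * k * M - b * Real.log M - Real.log ‖f 0‖ with hK
  have hev : ∀ᶠ x : ℝ in Filter.atTop, a * x - b * Real.log x > K := by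
    filter_upwards [hlo, Filter.eventually_gt_atTop (2 * K / a), Filter.eventually_gt_atTop 0]
      with x hx hxK hx0
    have h1 : Real.log x ≤ a / (2 * b) * x := by
      refine (le_abs_self _).trans ?_
      simpa [abs_of_pos hx0] using hx
    have h2 : b * Real.log x ≤ a / 2 * x := by
      calc b * Real.log x ≤ b * (a / (2 * b) * x) := by gcongr
        _ = a / 2 * x := by field_simp
    rw [div_lt_iff₀ hapos] at hxK
    linarith
  have hev' := (Filter.tendsto_atTop_add_const_left _ M
    (tendsto_natCast_atTop_atTop (R := ℝ))).eventually hev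
  obtain ⟨N, hN⟩ := hev'.exists
  have hm := main N
  have e1 : 2 * τ * (d * (M + N)) / Real.pi = 2 * τ * d / Real.pi * (M + N) := by ring
  rw [e1] at hm
  rw [ha] at hN
  rw [hK, hb] at hN
  linarith

/-! ### Normal families and a uniform lower bound for the samples. -/

/-- A form of Montel's theorem: entire functions that are uniformly bounded on horizontal strips
converge locally uniformly along any ultrafilter. -/
theorem exists_tendstoLocallyUniformlyOn_of_exponential_type {τ : ℝ} (hτ : 0 ≤ τ)
    {f : ℕ → ℂ → ℂ} (hf : ∀ n, Differentiable ℂ (f n))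
    (hgrowth : ∀ n z, ‖f n z‖ ≤ Real.exp (τ * |z.im|)) (U : Ultrafilter ℕ) :
    ∃ g : ℂ → ℂ, TendstoLocallyUniformlyOn f g U Set.univ := by
  have hlim : ∀ z, ∃ w, Filter.Tendsto (fun n => f n z) U (nhds w) := by
    intro z
    obtain ⟨w, _, hw⟩ := (isCompact_closedBall (0:ℂ) (Real.exp (τ * |z.im|))).ultrafilter_le_nhds
      (U.map fun n => f n z) (by
        rw [Filter.le_principal_iff, Ultrafilter.mem_coe, Ultrafilter.mem_map]
        exact Filter.Eventually.of_forall fun n => by simpa using hgrowth n z)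
    exact ⟨w, hw⟩
  choose g hg using hlim
  refine ⟨g, ?_⟩
  rw [Metric.tendstoLocallyUniformlyOn_iff]
  intro ε hε z₀ _
  -- Unit circles centred in the unit ball about `z₀` stay within `|Im z₀| + 2`, so Cauchy's
  -- estimate makes `D` a Lipschitz constant common to all `f n`. Equicontinuity turns pointwise
  -- limits into locally uniform ones.
  set D := Real.exp (τ * (|z₀.im| + 2)) with hD
  have hDpos : 0 < D := Real.exp_pos _
  have hlip : ∀ n, ∀ z ∈ Metric.ball z₀ 1, ‖f n z - f n z₀‖ ≤ D * ‖z - z₀‖ := by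
    intro n z hz
    refine (convex_ball z₀ 1).norm_image_sub_le_of_norm_deriv_le (𝕜 := ℂ)
      (fun w _ => (hf n) w) (fun w hw => ?_) (Metric.mem_ball_self one_pos) hz
    have := Complex.norm_deriv_le_of_forall_mem_sphere_norm_le (c := w) (R := 1) (C := D) one_pos
      (hf n).diffContOnCl (fun v hv => (hgrowth n v).trans ?_)
    · simpa using this
    · refine Real.exp_le_exp.2 (mul_le_mul_of_nonneg_left ?_ hτ)
      have h1 : |v.im - w.im| ≤ 1 := by
        rw [← Complex.sub_im]
        exact (Complex.abs_im_le_norm _).trans (by simpa [dist_eq_norm] using hv.le)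
      have h2 : |w.im - z₀.im| ≤ 1 := by
        rw [← Complex.sub_im]
        refine (Complex.abs_im_le_norm _).trans ?_
        rw [← dist_eq_norm]; exact (Metric.mem_ball.1 hw).le
      have h3 := abs_add_three (v.im - w.im) (w.im - z₀.im) z₀.im
      simp only [sub_add_sub_cancel, sub_add_cancel] at h3
      linarith
  have hglip : ∀ z ∈ Metric.ball z₀ 1, ‖g z - g z₀‖ ≤ D * ‖z - z₀‖ := by
    intro z hz
    exact le_of_tendsto ((hg z).sub (hg z₀)).norm (Filter.Eventually.of_forall fun n => hlip n z hz)
  refine ⟨Metric.ball z₀ (min 1 (ε / (4 * D))), mem_nhdsWithin_of_mem_nhds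
    (Metric.ball_mem_nhds _ (by positivity)), ?_⟩
  filter_upwards [Metric.tendsto_nhds.1 (hg z₀) (ε / 4) (by positivity)] with n hn z hz
  have hz1 : z ∈ Metric.ball z₀ 1 := Metric.ball_subset_ball (min_le_left _ _) hz
  have hz2 : D * ‖z - z₀‖ ≤ ε / 4 := by
    have : ‖z - z₀‖ < ε / (4 * D) := by
      rw [← dist_eq_norm]; exact lt_of_lt_of_le hz (min_le_right _ _)
    rw [lt_div_iff₀ (by positivity)] at this
    linarith
  rw [dist_eq_norm] at hn ⊢
  have e : g z - f n z = (g z - g z₀) - (f n z - f n z₀) - (f n z₀ - g z₀) := by ring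
  rw [e]
  have h1 := hlip n z hz1
  have h2 := hglip z hz1
  have h3 := norm_sub_le ((g z - g z₀) - (f n z - f n z₀)) (f n z₀ - g z₀)
  have h4 := norm_sub_le (g z - g z₀) (f n z - f n z₀)
  linarith

theorem Differentiable.differentiable_iteratedDeriv_complex {f : ℂ → ℂ} (hf : Differentiable ℂ f)
    (l : ℕ) : Differentiable ℂ (iteratedDeriv l f) :=
  (hf.contDiff (n := (l + 1 : ℕ))).differentiable_iteratedDeriv l (by
    exact_mod_cast Nat.lt_succ_self l)

theorem TendstoLocallyUniformlyOn.iteratedDeriv_univ {U : Filter ℕ} {f : ℕ → ℂ → ℂ}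
    {g : ℂ → ℂ} (hf : ∀ n, Differentiable ℂ (f n))
    (h : TendstoLocallyUniformlyOn f g U Set.univ) (l : ℕ) :
    TendstoLocallyUniformlyOn (fun n => iteratedDeriv l (f n)) (iteratedDeriv l g) U Set.univ := by
  induction l with
  | zero => simpa using h
  | succ l ih =>
    simp only [iteratedDeriv_succ]
    exact ih.deriv (Filter.Eventually.of_forall fun n =>
      ((hf n).differentiable_iteratedDeriv_complex l).differentiableOn) isOpen_univ

/-- Compactness version of `eq_zero_of_dense_zeros`. -/
theorem exists_uniform_sample_lower_bound {k : ℕ} {τ d : ℝ} (C : ℝ) {γ : ℝ} (hγ : 0 < γ)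
    (hτ : 0 ≤ τ) (hd : 0 < d) (hτd : τ * d < k * Real.pi) :
    ∃ η : ℝ, 0 < η ∧ ∀ (X : ℤ → ℝ) (f : ℂ → ℂ), SeparatedBy X γ →
      (∀ i, |X i| ≤ C + d * |(i : ℝ)|) → Differentiable ℂ f →
      (∀ z, ‖f z‖ ≤ Real.exp (τ * |z.im|)) → 1 / 2 ≤ ‖f 0‖ →
      ∃ i, ∃ l < k, η < ‖iteratedDeriv l f (X i : ℂ)‖ := by
  by_contra hcon
  push Not at hcon
  choose X f hsep hXb hf hgrowth hf0 hsmall using fun n : ℕ =>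
    hcon (1 / ((n : ℝ) + 1)) (by positivity)
  set U : Ultrafilter ℕ := Filter.hyperfilter ℕ
  have hU : (U : Filter ℕ) ≤ Filter.atTop := by
    rw [← Nat.cofinite_eq_atTop]; exact Filter.hyperfilter_le_cofinite
  obtain ⟨g, hg⟩ := exists_tendstoLocallyUniformlyOn_of_exponential_type hτ hf hgrowth U
  have hgdiff : Differentiable ℂ g := by
    rw [← differentiableOn_univ]
    exact hg.differentiableOn (Filter.Eventually.of_forall fun n => (hf n).differentiableOn)
      isOpen_univ
  have hpt : ∀ z, Filter.Tendsto (fun n => f n z) U (nhds (g z)) := fun z =>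
    hg.tendsto_at (Set.mem_univ z)
  have hlim : ∀ i, ∃ w, Filter.Tendsto (fun n => X n i) U (nhds w) := by
    intro i
    obtain ⟨w, _, hw⟩ := (isCompact_Icc (a := -(C + d * |(i:ℝ)|))
      (b := C + d * |(i:ℝ)|)).ultrafilter_le_nhds
      (U.map fun n => X n i) (by
        rw [Filter.le_principal_iff, Ultrafilter.mem_coe, Ultrafilter.mem_map]
        exact Filter.Eventually.of_forall fun n => abs_le.1 (hXb n i))
    exact ⟨w, hw⟩
  choose Y hY using hlim
  have hg0 : g 0 = 0 := by
    refine eq_zero_of_dense_zeros hτ hd hτd hgdiff (fun z => ?_) Y ?_ (C := C) (fun i => ?_) ?_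
    · exact le_of_tendsto (hpt z).norm (Filter.Eventually.of_forall fun n => hgrowth n z)
    -- The uniform separation survives the limit, so nodes cannot merge and no zeros are lost.
    · intro i j hij
      by_contra hne
      have : γ ≤ |Y i - Y j| := ge_of_tendsto ((hY i).sub (hY j)).abs
        (Filter.Eventually.of_forall fun n => hsep n i j hne)
      rw [hij] at this
      simp at this; linarith
    · exact le_of_tendsto (hY i).abs (Filter.Eventually.of_forall fun n => hXb n i)
    · intro i l hl
      have h1 := hg.iteratedDeriv_univ hf l
      have h2 : Filter.Tendsto (fun n => iteratedDeriv l (f n) (X n i : ℂ)) U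
          (nhds (iteratedDeriv l g (Y i : ℂ))) := by
        rw [tendstoLocallyUniformlyOn_univ] at h1
        exact h1.tendsto_comp (hgdiff.differentiable_iteratedDeriv_complex l).continuous.continuousAt
          ((Complex.continuous_ofReal.tendsto _).comp (hY i))
      have h3 : Filter.Tendsto (fun n => iteratedDeriv l (f n) (X n i : ℂ)) U (nhds 0) :=
        squeeze_zero_norm (fun n => hsmall n i l hl)
          ((tendsto_one_div_add_atTop_nhds_zero_nat (𝕜 := ℝ)).mono_left hU)
      exact tendsto_nhds_unique h2 h3
  have := ge_of_tendsto (hpt 0).norm (Filter.Eventually.of_forall hf0)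
  rw [hg0] at this
  norm_num at this

/-! ### Sampling in the supremum norm. -/

/-- Phragmén–Lindelöf for functions of exponential type bounded on the real line. -/
theorem norm_le_mul_exp_of_norm_le_on_real {τ M S : ℝ} {f : ℂ → ℂ} (hf : Differentiable ℂ f)
    (hgrowth : ∀ z, ‖f z‖ ≤ M * Real.exp (τ * |z.im|)) (hS : ∀ x : ℝ, ‖f x‖ ≤ S) (z : ℂ) :
    ‖f z‖ ≤ S * Real.exp (τ * |z.im|) := by
  -- A quarter turn carries the right half-plane to the upper or lower one, where `exp (-τ w)`
  -- cancels the growth.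
  have key : ∀ c : ℂ, (c = Complex.I ∨ c = -Complex.I) → ∀ w : ℂ, 0 ≤ w.re →
      ‖f (c * w)‖ ≤ S * Real.exp (τ * w.re) := by
    intro c hc w hw
    have him : ∀ w : ℂ, 0 ≤ w.re → |(c * w).im| = w.re := by
      intro w hw
      rcases hc with rfl | rfl <;> simp [abs_of_nonneg hw]
    have hnorm : ∀ w : ℂ, ‖f (c * w) * Complex.exp (-(τ * w))‖ =
        ‖f (c * w)‖ * Real.exp (-(τ * w.re)) := by
      intro w
      rw [norm_mul, Complex.norm_exp]; simp
    have hM : ∀ w : ℂ, 0 ≤ w.re → ‖f (c * w) * Complex.exp (-(τ * w))‖ ≤ M := by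
      intro w hw
      rw [hnorm]
      have := hgrowth (c * w)
      rw [him w hw] at this
      calc _ ≤ M * Real.exp (τ * w.re) * Real.exp (-(τ * w.re)) := by gcongr
        _ = M := by rw [mul_assoc, ← Real.exp_add]; simp
    have := PhragmenLindelof.right_half_plane_of_bounded_on_real
      (f := fun w => f (c * w) * Complex.exp (-(τ * w))) (C := S) (z := w)
      (by
        apply Differentiable.diffContOnCl
        exact (hf.comp (differentiable_id.const_mul c)).mul (by fun_prop))
      -- The damped function is bounded, so growth exponent `1 < 2` with coefficient `0` is
      -- admissible.
      ⟨1, by norm_num, 0, by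
        refine Asymptotics.IsBigO.of_bound M ?_
        refine Filter.eventually_inf_principal.2 (Filter.Eventually.of_forall fun w hw => ?_)
        simpa using hM w (le_of_lt hw)⟩
      ⟨M, by
        rw [Filter.eventually_map]
        filter_upwards [Filter.eventually_ge_atTop 0] with x hx
        exact hM x (by simpa using hx)⟩
      (by
        intro x
        rw [hnorm]
        obtain ⟨y, hy⟩ : ∃ y : ℝ, c * (x * Complex.I) = y := by
          rcases hc with rfl | rfl
          · exact ⟨-x, by push_cast; linear_combination (x:ℂ) * Complex.I_mul_I⟩
          · exact ⟨x, by linear_combination -(x:ℂ) * Complex.I_mul_I⟩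
        rw [hy]
        simpa using hS y)
      hw
    rw [hnorm, Real.exp_neg, ← div_eq_mul_inv, div_le_iff₀ (Real.exp_pos _)] at this
    exact this
  rcases le_total 0 z.im with h | h
  · have := key Complex.I (Or.inl rfl) (-Complex.I * z) (by simpa using h)
    rw [abs_of_nonneg h]
    have e : Complex.I * (-Complex.I * z) = z := by linear_combination -z * Complex.I_mul_I
    rw [e] at this
    simpa using this
  · have := key (-Complex.I) (Or.inr rfl) (Complex.I * z) (by simpa using h)
    rw [abs_of_nonpos h]
    have e : -Complex.I * (Complex.I * z) = z := by linear_combination -z * Complex.I_mul_I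
    rw [e] at this
    simpa using this

/-- Sampling with derivatives for bounded functions of exponential type. -/
theorem exists_norm_le_mul_of_samples {k : ℕ} (hk : 1 ≤ k) {τ : ℝ} (hτ : 0 ≤ τ)
    {x : ℤ → ℝ} (hx : StrictMono x) {γ : ℝ} (hγ : 0 < γ) (hsep : SeparatedBy x γ)
    {ν : ℕ} (hν : 1 ≤ ν) {δ : ℝ} (hδ : ∀ i : ℤ, x (i + (ν : ℤ)) - x i ≤ δ)
    (hlt : τ * (δ / ν) < k * Real.pi) :
    ∃ K : ℝ, 0 < K ∧ ∀ (f : ℂ → ℂ) (M s : ℝ), Differentiable ℂ f →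
      (∀ z, ‖f z‖ ≤ M * Real.exp (τ * |z.im|)) →
      (∀ i, ∀ l < k, ‖iteratedDeriv l f (x i : ℂ)‖ ≤ s) → ∀ y : ℝ, ‖f y‖ ≤ K * s := by
  have hνpos : (0:ℝ) < ν := by exact_mod_cast hν
  have hδpos : 0 < δ := by
    have h1 := hδ 0
    have h2 : x 0 < x (0 + (ν:ℤ)) := hx (by omega)
    linarith
  set d := δ / ν with hd
  have hdpos : 0 < d := by positivity
  have hgap : ∀ (n : ℕ) (i : ℤ), x i + γ * n ≤ x (i + n) := by
    intro n i
    induction n with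
    | zero => simp
    | succ n ih =>
      have h1 := hsep (i + n + 1) (i + n) (by omega)
      have h2 : x (i + n) < x (i + n + 1) := hx (by omega)
      rw [abs_of_pos (by linarith)] at h1
      push_cast
      rw [← add_assoc]
      linarith
  have hstep : ∀ (q : ℕ) (i : ℤ), x (i + q * ν) ≤ x i + q * δ := by
    intro q i
    induction q with
    | zero => simp
    | succ q ih =>
      have h1 := hδ (i + q * ν)
      push_cast
      have e : i + ((q:ℤ) + 1) * ν = i + q * ν + ν := by ring
      rw [e]; linarith
  have hupper : ∀ (n : ℕ) (i : ℤ), x (i + n) ≤ x i + δ + d * n := by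
    intro n i
    -- Rounding `n` up to a multiple of `ν` costs at most one extra gap `δ`.
    have h1 : n < (n / ν + 1) * ν := by
      have := Nat.lt_div_mul_add (a := n) (b := ν) (by omega)
      linarith
    have h2 : x (i + n) ≤ x (i + ((n / ν + 1 : ℕ) : ℤ) * ν) := by
      refine hx.monotone ?_
      have : (n : ℤ) < ((n / ν + 1 : ℕ) : ℤ) * ν := by exact_mod_cast h1
      linarith
    have h3 := hstep (n / ν + 1) i
    have h4 : ((n / ν : ℕ) : ℝ) * δ ≤ d * n := by
      have : ((n / ν : ℕ) : ℝ) ≤ n / ν := Nat.cast_div_le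
      calc ((n / ν : ℕ) : ℝ) * δ ≤ n / ν * δ := by gcongr
        _ = d * n := by rw [hd]; ring
    push_cast at h2 h3
    linarith
  -- In `2 * δ`, one `δ` comes from `hupper` and one from the distance between the base point and
  -- the nearest node to its left.
  obtain ⟨η, hη, hmain⟩ := exists_uniform_sample_lower_bound (2 * δ) hγ hτ hdpos hlt
  refine ⟨1 / η, by positivity, fun f M s hf hgrowth hs y => ?_⟩
  have hM : ∀ t : ℝ, ‖f t‖ ≤ M := fun t => by simpa using hgrowth t
  have hbdd : BddAbove (Set.range fun t : ℝ => ‖f t‖) := ⟨M, by rintro _ ⟨t, rfl⟩; exact hM t⟩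
  set S := ⨆ t : ℝ, ‖f t‖ with hS
  have hfS : ∀ t : ℝ, ‖f t‖ ≤ S := fun t => le_ciSup hbdd t
  refine (hfS y).trans ?_
  rcases ((norm_nonneg _).trans (hfS 0)).eq_or_lt with h0 | hSpos
  · rw [← h0]
    have : 0 ≤ s := (norm_nonneg _).trans (hs 0 0 hk)
    positivity
  -- The supremum need not be attained; half of it is enough for the normalized translate `S⁻¹ f(· +
  -- y')`. The crude bound `M` serves only to make `S` finite, and Phragmén–Lindelöf then replaces
  -- it by `S`.
  obtain ⟨y', hy'⟩ := exists_lt_of_lt_ciSup (show S / 2 < ⨆ t : ℝ, ‖f t‖ by rw [← hS]; linarith)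
  have hPL := norm_le_mul_exp_of_norm_le_on_real hf hgrowth hfS
  obtain ⟨i₀, hi₀, hi₀max⟩ : ∃ i₀ : ℤ, x i₀ ≤ y' ∧ ∀ z, x z ≤ y' → z ≤ i₀ := by
    refine Int.exists_greatest_of_bdd (P := fun i => x i ≤ y') ?_ ?_
    · obtain ⟨n, hn⟩ := exists_nat_gt ((y' - x 0) / γ)
      rw [div_lt_iff₀ hγ] at hn
      refine ⟨n, fun z hz => ?_⟩
      by_contra hlt
      push Not at hlt
      have h1 := hx hlt
      have h2 := hgap n 0
      simp only [zero_add] at h2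
      linarith
    · obtain ⟨n, hn⟩ := exists_nat_gt ((x 0 - y') / γ)
      rw [div_lt_iff₀ hγ] at hn
      refine ⟨-n, ?_⟩
      have h2 := hgap n (-n)
      simp only [neg_add_cancel] at h2
      linarith
  have hi₁ : y' < x (i₀ + 1) := by
    by_contra h
    push Not at h
    have := hi₀max _ h
    omega
  have hi₂ : x (i₀ + 1) ≤ x i₀ + δ := by
    have h1 : x (i₀ + 1) ≤ x (i₀ + ν) := hx.monotone (by omega)
    linarith [hδ i₀]
  obtain ⟨i, l, hl, hil⟩ := hmain (fun j => x (i₀ + j) - y') (fun z => (S : ℂ)⁻¹ * f (z + y'))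
    (by
      intro i j hij
      have := hsep (i₀ + i) (i₀ + j) (by omega)
      simpa using this)
    (by
      intro j
      rcases le_total 0 j with h | h
      · obtain ⟨n, rfl⟩ := Int.eq_ofNat_of_zero_le h
        have h1 := hupper n i₀
        have h2 : x i₀ ≤ x (i₀ + n) := hx.monotone (by omega)
        have h3 : 0 ≤ d * (n:ℝ) := by positivity
        simp only [Int.cast_natCast, Nat.abs_cast]
        rw [abs_le]; constructor <;> linarith
      · obtain ⟨n, hn⟩ := Int.eq_ofNat_of_zero_le (show 0 ≤ -j by omega)
        obtain rfl : j = -n := by omega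
        have h1 := hupper n (i₀ + -n)
        simp only [neg_add_cancel_right] at h1
        have h2 : x (i₀ + -n) ≤ x i₀ := hx.monotone (by omega)
        simp only [Int.cast_neg, Int.cast_natCast, abs_neg, Nat.abs_cast]
        have h3 : 0 ≤ d * (n:ℝ) := by positivity
        rw [abs_le]; constructor <;> linarith)
    ((hf.comp (differentiable_id.add_const _)).const_mul _)
    (by
      intro z
      rw [norm_mul, norm_inv, Complex.norm_real, Real.norm_of_nonneg hSpos.le,
        inv_mul_le_iff₀ hSpos]
      simpa using hPL (z + y'))
    (by
      rw [norm_mul, norm_inv, Complex.norm_real, Real.norm_of_nonneg hSpos.le, zero_add]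
      rw [← div_eq_inv_mul, le_div_iff₀ hSpos]
      linarith)
  have e : iteratedDeriv l (fun z => (S : ℂ)⁻¹ * f (z + y')) ((x (i₀ + i) - y' : ℝ) : ℂ) =
      (S : ℂ)⁻¹ * iteratedDeriv l f (x (i₀ + i) : ℂ) := by
    have hcd : ContDiff ℂ l fun z : ℂ => f (z + y') :=
      (hf.comp (differentiable_id.add_const _)).contDiff
    rw [iteratedDeriv_const_mul_field, iteratedDeriv_comp_add_const]
    simp
  rw [e, norm_mul, norm_inv, Complex.norm_real, Real.norm_of_nonneg hSpos.le, ← div_eq_inv_mul,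
    lt_div_iff₀ hSpos] at hil
  have := hs (i₀ + i) l hl
  rw [one_div, ← div_eq_inv_mul, le_div_iff₀ hη]
  linarith

/-! ### Bandlimited functions as restrictions of entire functions. -/

/-- On `L² ∩ L¹` the inverse Plancherel transform is given by the Fourier integral. -/
theorem fourierInv_ae_eq_of_integrable (ψ : Lp ℂ 2 (volume : Measure ℝ))
    (hψ : Integrable (ψ : ℝ → ℂ)) :
    ((𝓕⁻ ψ : Lp ℂ 2 (volume : Measure ℝ)) : ℝ → ℂ) =ᵐ[volume] 𝓕⁻ (ψ : ℝ → ℂ) := by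
  have hcont : Continuous (𝓕⁻ (ψ : ℝ → ℂ)) :=
    VectorFourier.fourierIntegral_continuous Real.continuous_fourierChar
      (L := -innerₗ ℝ) (by
        simp only [LinearMap.neg_apply, innerₗ_apply_apply]
        fun_prop) hψ
  -- It suffices to test against smooth `g` of compact support: the transform moves onto `g` by
  -- duality of tempered distributions on the `L²` side and by Fubini on the `L¹` side.
  refine ae_eq_of_integral_contDiff_smul_eq ?_ hcont.locallyIntegrable fun g hg hgs => ?_
  · exact (Lp.memLp _).locallyIntegrable (by norm_num)
  have hgC : ContDiff ℝ ∞ fun x => (g x : ℂ) := Complex.ofRealCLM.contDiff.comp hg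
  have hgCs : HasCompactSupport fun x => (g x : ℂ) := hgs.comp_left Complex.ofReal_zero
  set G : SchwartzMap ℝ ℂ := hgCs.toSchwartzMap hgC with hG
  have hGapp : ∀ x, G x = (g x : ℂ) := fun x => rfl
  have h1 : Lp.toTemperedDistribution (𝓕⁻ ψ : Lp ℂ 2 (volume : Measure ℝ)) G =
      Lp.toTemperedDistribution ψ (𝓕⁻ G) := by
    rw [← Lp.fourierInv_toTemperedDistribution_eq]
    rfl
  rw [Lp.toTemperedDistribution_apply, Lp.toTemperedDistribution_apply] at h1
  simp only [hGapp] at h1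
  have h2 : ∫ x, (𝓕⁻ G) x • (ψ : ℝ → ℂ) x = ∫ x, G x • 𝓕⁻ (ψ : ℝ → ℂ) x := by
    rw [SchwartzMap.fourierInv_coe]
    have := VectorFourier.integral_fourierIntegral_smul_eq_flip (μ := volume) (ν := volume)
      (L := -innerₗ ℝ) (f := (G : ℝ → ℂ)) (g := (ψ : ℝ → ℂ))
      Real.continuous_fourierChar (by
        simp only [LinearMap.neg_apply, innerₗ_apply_apply]
        fun_prop) G.integrable hψ
    have hflip : (-innerₗ ℝ : ℝ →ₗ[ℝ] ℝ →ₗ[ℝ] ℝ).flip = -innerₗ ℝ := by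
      ext; simp
    rw [hflip] at this
    exact this
  rw [h2] at h1
  simpa [hGapp] using h1

/-- The entire function with spectral density `φ` on `[-a, a]`. -/
noncomputable def bandExt (a : ℝ) (φ : ℝ → ℂ) (z : ℂ) : ℂ :=
  ∫ w in Set.Icc (-a) a, φ w * Complex.exp (2 * Real.pi * Complex.I * w * z)

theorem norm_exp_two_pi_mul_le {a w : ℝ} (hw : w ∈ Set.Icc (-a) a) (z : ℂ) :
    ‖Complex.exp (2 * Real.pi * Complex.I * w * z)‖ ≤ Real.exp (2 * Real.pi * a * |z.im|) := by
  rw [Complex.norm_exp]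
  refine Real.exp_le_exp.2 ?_
  have : (2 * Real.pi * Complex.I * w * z).re = -(2 * Real.pi * (w * z.im)) := by
    simp [Complex.mul_re, Complex.mul_im]; ring
  rw [this]
  have h1 : |w * z.im| ≤ a * |z.im| := by
    rw [abs_mul]; gcongr; exact abs_le.2 hw
  have h2 := neg_abs_le (w * z.im)
  have hpi := Real.pi_pos
  nlinarith

theorem integrableOn_mul_exp {a : ℝ} {φ : ℝ → ℂ} (hφ : IntegrableOn φ (Set.Icc (-a) a)) (z : ℂ) :
    IntegrableOn (fun w : ℝ => φ w * Complex.exp (2 * Real.pi * Complex.I * w * z))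
      (Set.Icc (-a) a) := by
  refine Integrable.mono' (hφ.norm.mul_const (Real.exp (2 * Real.pi * a * |z.im|))) ?_ ?_
  · exact hφ.1.mul (by fun_prop : Continuous fun w : ℝ =>
      Complex.exp (2 * Real.pi * Complex.I * w * z)).aestronglyMeasurable
  · filter_upwards [ae_restrict_mem measurableSet_Icc] with w hw
    rw [norm_mul]
    gcongr
    exact norm_exp_two_pi_mul_le hw z

theorem norm_bandExt_le {a : ℝ} {φ : ℝ → ℂ} (hφ : IntegrableOn φ (Set.Icc (-a) a)) (z : ℂ) :
    ‖bandExt a φ z‖ ≤ (∫ w in Set.Icc (-a) a, ‖φ w‖) * Real.exp (2 * Real.pi * a * |z.im|) := by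
  unfold bandExt
  refine (norm_integral_le_integral_norm _).trans ?_
  rw [← integral_mul_const]
  refine integral_mono_ae (integrableOn_mul_exp hφ z).norm (hφ.norm.mul_const _) ?_
  filter_upwards [ae_restrict_mem measurableSet_Icc] with w hw
  rw [norm_mul]
  gcongr
  exact norm_exp_two_pi_mul_le hw z

theorem integrableOn_pow_mul {a : ℝ} {φ : ℝ → ℂ} (hφ : IntegrableOn φ (Set.Icc (-a) a)) (l : ℕ) :
    IntegrableOn (fun w : ℝ => (2 * Real.pi * Complex.I * w) ^ l * φ w) (Set.Icc (-a) a) := by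
  refine IntegrableOn.continuousOn_mul ?_ hφ isCompact_Icc
  fun_prop

theorem hasDerivAt_bandExt {a : ℝ} {φ : ℝ → ℂ} (hφ : IntegrableOn φ (Set.Icc (-a) a)) (z : ℂ) :
    HasDerivAt (bandExt a φ) (bandExt a (fun w => 2 * Real.pi * Complex.I * w * φ w) z) z := by
  have hφ1 : IntegrableOn (fun w : ℝ => 2 * Real.pi * Complex.I * w * φ w) (Set.Icc (-a) a) := by
    simpa using integrableOn_pow_mul hφ 1
  refine (hasDerivAt_integral_of_dominated_loc_of_deriv_le (𝕜 := ℂ)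
    (s := Metric.ball z 1)
    (bound := fun w => ‖2 * Real.pi * Complex.I * w * φ w‖ *
      Real.exp (2 * Real.pi * a * (|z.im| + 1)))
    (F' := fun z w => 2 * Real.pi * Complex.I * w * φ w *
      Complex.exp (2 * Real.pi * Complex.I * w * z))
    (Metric.ball_mem_nhds _ one_pos)
    (Filter.Eventually.of_forall fun x => (integrableOn_mul_exp hφ x).1)
    (integrableOn_mul_exp hφ z) (integrableOn_mul_exp hφ1 z).1 ?_ (hφ1.norm.mul_const _) ?_).2
  · filter_upwards [ae_restrict_mem measurableSet_Icc] with w hw x hx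
    rw [norm_mul]
    refine mul_le_mul_of_nonneg_left ((norm_exp_two_pi_mul_le hw x).trans ?_) (norm_nonneg _)
    have ha : 0 ≤ a := by linarith [hw.1, hw.2]
    have hx1 : |x.im - z.im| ≤ 1 := by
      rw [← Complex.sub_im]
      refine (Complex.abs_im_le_norm _).trans ?_
      rw [← dist_eq_norm]; exact (Metric.mem_ball.1 hx).le
    have := abs_sub_abs_le_abs_sub x.im z.im
    refine Real.exp_le_exp.2 (mul_le_mul_of_nonneg_left (by linarith) (by positivity))
  · refine Filter.Eventually.of_forall fun w x _ => ?_
    have h1 : HasDerivAt (fun x : ℂ => 2 * Real.pi * Complex.I * w * x)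
        (2 * Real.pi * Complex.I * w) x := by
      simpa using (hasDerivAt_id x).const_mul (2 * Real.pi * Complex.I * w)
    have := (h1.cexp).const_mul (φ w)
    convert! this using 1
    ring

theorem differentiable_bandExt {a : ℝ} {φ : ℝ → ℂ} (hφ : IntegrableOn φ (Set.Icc (-a) a)) :
    Differentiable ℂ (bandExt a φ) := fun z => (hasDerivAt_bandExt hφ z).differentiableAt

theorem iteratedDeriv_bandExt {a : ℝ} {φ : ℝ → ℂ} (hφ : IntegrableOn φ (Set.Icc (-a) a)) (l : ℕ) :
    iteratedDeriv l (bandExt a φ) =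
      bandExt a (fun w => (2 * Real.pi * Complex.I * w) ^ l * φ w) := by
  induction l with
  | zero => simp
  | succ l ih =>
    rw [iteratedDeriv_succ, ih]
    ext z
    rw [(hasDerivAt_bandExt (integrableOn_pow_mul hφ l) z).deriv]
    congr 1
    ext w
    ring

/-- The restriction of an entire function to the real line has the same derivatives. -/
theorem iteratedDeriv_comp_ofReal {f : ℂ → ℂ} (hf : Differentiable ℂ f) (l : ℕ) (x : ℝ) :
    iteratedDeriv l (fun t : ℝ => f t) x = iteratedDeriv l f x := by
  induction l generalizing x with
  | zero => simp
  | succ l ih =>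
    rw [iteratedDeriv_succ, iteratedDeriv_succ, funext ih]
    exact ((hf.differentiable_iteratedDeriv_complex l).differentiableAt.hasDerivAt.comp_ofReal).deriv

theorem bandExt_eq_fourierInv (a : ℝ) (φ : ℝ → ℂ) (x : ℝ) :
    bandExt a φ x = 𝓕⁻ ((Set.Icc (-a) a).indicator φ) x := by
  rw [Real.fourierInv_eq', bandExt, ← integral_indicator measurableSet_Icc]
  congr 1
  ext w
  by_cases hw : w ∈ Set.Icc (-a) a
  · simp only [Set.indicator_of_mem hw, smul_eq_mul, RCLike.inner_apply,
      conj_trivial]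
    rw [mul_comm]
    congr 2
    push_cast
    ring
  · simp [Set.indicator_of_notMem hw]

/-- Plancherel for `bandExt`. -/
theorem memLp_bandExt {a : ℝ} {φ : ℝ → ℂ} (hφ : MemLp φ 2 (volume.restrict (Set.Icc (-a) a))) :
    MemLp (fun x : ℝ => bandExt a φ x) 2 volume ∧
      eLpNorm (fun x : ℝ => bandExt a φ x) 2 volume =
        eLpNorm φ 2 (volume.restrict (Set.Icc (-a) a)) := by
  have hind : MemLp ((Set.Icc (-a) a).indicator φ) 2 volume :=
    (memLp_indicator_iff_restrict measurableSet_Icc).2 hφ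
  set ψ := hind.toLp with hψ
  have hψae : (ψ : ℝ → ℂ) =ᵐ[volume] (Set.Icc (-a) a).indicator φ := hind.coeFn_toLp
  have hint : Integrable (ψ : ℝ → ℂ) := by
    rw [integrable_congr hψae, integrable_indicator_iff measurableSet_Icc]
    exact hφ.integrable (by norm_num)
  have hae : ((𝓕⁻ ψ : Lp ℂ 2 (volume : Measure ℝ)) : ℝ → ℂ) =ᵐ[volume]
      fun x : ℝ => bandExt a φ x := by
    refine (fourierInv_ae_eq_of_integrable ψ hint).trans (Filter.Eventually.of_forall fun x => ?_)
    beta_reduce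
    rw [bandExt_eq_fourierInv]
    exact Real.fourierInv_congr_ae hψae x
  refine ⟨(memLp_congr_ae hae).1 (Lp.memLp _), ?_⟩
  rw [← eLpNorm_congr_ae hae, ← eLpNorm_indicator_eq_eLpNorm_restrict measurableSet_Icc,
    ← eLpNorm_congr_ae hψae]
  have h1 : ‖(𝓕⁻ ψ : Lp ℂ 2 (volume : Measure ℝ))‖ = ‖ψ‖ := by
    rw [← Lp.norm_fourier_eq, FourierTransform.fourier_fourierInv_eq]
  rw [Lp.norm_def, Lp.norm_def, ENNReal.toReal_eq_toReal_iff' (Lp.eLpNorm_ne_top _)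
    (Lp.eLpNorm_ne_top _)] at h1
  exact h1

/-- The smooth representative of a bandlimited function. -/
theorem Bandlimited.ae_eq_bandExt {σ : ℝ} {f : Lp ℂ 2 (volume : Measure ℝ)}
    (hf : f ∈ Bandlimited σ) :
    (fun x : ℝ => bandExt (σ / (2 * Real.pi)) (𝓕 f : Lp ℂ 2 (volume : Measure ℝ)) x)
      =ᵐ[volume] f := by
  set ψ : Lp ℂ 2 (volume : Measure ℝ) := 𝓕 f with hψ
  set a := σ / (2 * Real.pi)
  have hind : (ψ : ℝ → ℂ) =ᵐ[volume] (Set.Icc (-a) a).indicator (ψ : ℝ → ℂ) := by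
    have h : ∀ᵐ w : ℝ, w ∉ Set.Icc (-a) a → ψ w = 0 := hf
    filter_upwards [h] with w hw
    by_cases hm : w ∈ Set.Icc (-a) a
    · rw [Set.indicator_of_mem hm]
    · rw [Set.indicator_of_notMem hm, hw hm]
  have hint : Integrable (ψ : ℝ → ℂ) := by
    rw [integrable_congr hind, integrable_indicator_iff measurableSet_Icc]
    exact ((Lp.memLp ψ).restrict _).integrable (by norm_num)
  have h1 := fourierInv_ae_eq_of_integrable ψ hint
  rw [hψ, FourierTransform.fourierInv_fourier_eq, ← hψ] at h1
  refine (h1.trans (Filter.Eventually.of_forall fun x => ?_)).symm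
  rw [bandExt_eq_fourierInv]
  exact Real.fourierInv_congr_ae hind x

/-! ### The upper frame bound. -/

/-- A one-dimensional Sobolev inequality. -/
theorem norm_sq_le_integral_add_deriv {G G' : ℝ → ℂ} (hG : ∀ t, HasDerivAt G (G' t) t)
    (hG' : Continuous G') (x : ℝ) {γ : ℝ} (hγ : 0 < γ) :
    ‖G x‖ ^ 2 ≤ (1 / γ + 1) * ∫ t in x..(x + γ), (‖G t‖ ^ 2 + ‖G' t‖ ^ 2) := by
  have hGc : Continuous G := continuous_iff_continuousAt.2 fun t => (hG t).continuousAt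
  set h : ℝ → ℝ := fun t => ‖G t‖ ^ 2 + ‖G' t‖ ^ 2 with hh
  have hc : Continuous h := by fun_prop
  have hi : ∀ a b, IntervalIntegrable h volume a b := fun a b => hc.intervalIntegrable a b
  have hnn : ∀ t, 0 ≤ h t := fun t => by positivity
  set I := ∫ t in x..(x + γ), h t with hI
  -- The derivative of `‖G‖²` is `2 ⟨G, G'⟩ ≥ -(‖G‖² + ‖G'‖²)`; integrating from `x` to `t` bounds
  -- the drop, and averaging over `t` then finishes.
  have hpt : ∀ t ∈ Set.Icc x (x + γ), ‖G x‖ ^ 2 ≤ ‖G t‖ ^ 2 + I := by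
    intro t ht
    have hinn : Continuous fun t => 2 * inner ℝ (G t) (G' t) := by fun_prop
    have h1 := intervalIntegral.integral_eq_sub_of_hasDerivAt
      (fun s _ => (hG s).norm_sq) (hinn.intervalIntegrable x t)
    have h2 : -∫ s in x..t, h s ≤ ∫ s in x..t, 2 * inner ℝ (G s) (G' s) := by
      rw [← intervalIntegral.integral_neg]
      refine intervalIntegral.integral_mono_on ht.1 (hi x t).neg (hinn.intervalIntegrable x t)
        fun s _ => ?_
      have h3 := neg_abs_le (inner ℝ (G s) (G' s))
      have h4 := abs_real_inner_le_norm (G s) (G' s)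
      have h5 := two_mul_le_add_sq ‖G s‖ ‖G' s‖
      simp only [hh]
      linarith
    have h3 : ∫ s in x..t, h s ≤ I := by
      rw [hI, ← intervalIntegral.integral_add_adjacent_intervals (hi x t) (hi t (x + γ))]
      have := intervalIntegral.integral_nonneg ht.2 (fun s _ => hnn s) (μ := volume)
      linarith
    linarith
  have h1 : γ * ‖G x‖ ^ 2 ≤ I + γ * I := by
    have h2 : ∫ t in x..(x + γ), ‖G x‖ ^ 2 ≤ ∫ t in x..(x + γ), (h t + I) := by
      refine intervalIntegral.integral_mono_on (by linarith) (by simp)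
        ((hi _ _).add (by simp)) fun t ht => (hpt t ht).trans ?_
      have : (0:ℝ) ≤ ‖G' t‖ ^ 2 := by positivity
      simp only [hh]; linarith
    rw [intervalIntegral.integral_add (hi _ _) (by simp)] at h2
    simpa using h2
  have : ‖G x‖ ^ 2 ≤ (I + γ * I) / γ := by
    rw [le_div_iff₀ hγ]; linarith
  refine this.trans (le_of_eq ?_)
  field_simp

theorem pairwise_disjoint_Ioc_of_separatedBy {x : ℤ → ℝ} {γ : ℝ} (hsep : SeparatedBy x γ) :
    Pairwise (Function.onFun Disjoint fun i => Set.Ioc (x i) (x i + γ)) := by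
  intro i j hij
  rw [Function.onFun, Set.disjoint_left]
  rintro t ⟨h1, h2⟩ ⟨h3, h4⟩
  have h5 := hsep i j hij
  have h6 : |x i - x j| < γ := by rw [abs_lt]; constructor <;> linarith
  linarith

/-- The Plancherel–Pólya inequality in terms of a Sobolev norm. -/
theorem summable_norm_sq_of_separatedBy {G G' : ℝ → ℂ} (hG : ∀ t, HasDerivAt G (G' t) t)
    (hG' : Continuous G') (h2 : MemLp G 2 volume) (h2' : MemLp G' 2 volume)
    {x : ℤ → ℝ} {γ : ℝ} (hγ : 0 < γ) (hsep : SeparatedBy x γ) :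
    Summable (fun i => ‖G (x i)‖ ^ 2) ∧
      ∑' i, ‖G (x i)‖ ^ 2 ≤ (1 / γ + 1) * ((∫ t, ‖G t‖ ^ 2) + ∫ t, ‖G' t‖ ^ 2) := by
  have i1 := (memLp_two_iff_integrable_sq_norm h2.1).1 h2
  have i2 := (memLp_two_iff_integrable_sq_norm h2'.1).1 h2'
  have hint : Integrable (fun t => ‖G t‖ ^ 2 + ‖G' t‖ ^ 2) := i1.add i2
  have hs := MeasureTheory.hasSum_integral_iUnion (fun i => measurableSet_Ioc)
    (pairwise_disjoint_Ioc_of_separatedBy hsep) (hint.integrableOn (s := ⋃ i, Set.Ioc (x i) (x i + γ)))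
  have hle : ∀ i, ‖G (x i)‖ ^ 2 ≤
      (1 / γ + 1) * ∫ t in Set.Ioc (x i) (x i + γ), (‖G t‖ ^ 2 + ‖G' t‖ ^ 2) := by
    intro i
    rw [← intervalIntegral.integral_of_le (by linarith)]
    exact norm_sq_le_integral_add_deriv hG hG' _ hγ
  have hs' := hs.mul_left (1 / γ + 1)
  have hsum : Summable (fun i => ‖G (x i)‖ ^ 2) :=
    Summable.of_nonneg_of_le (fun i => by positivity) hle hs'.summable
  refine ⟨hsum, (hsum.tsum_le_tsum hle hs'.summable).trans ?_⟩
  rw [hs'.tsum_eq, ← integral_add i1 i2]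
  exact mul_le_mul_of_nonneg_left (setIntegral_le_integral hint
    (Filter.Eventually.of_forall fun t => by positivity)) (by positivity)

theorem integral_norm_sq_eq_eLpNorm {α : Type*} {m : MeasurableSpace α} {μ : Measure α}
    {g : α → ℂ} (hg : MemLp g 2 μ) : ∫ t, ‖g t‖ ^ 2 ∂μ = (eLpNorm g 2 μ).toReal ^ 2 := by
  have hnn : 0 ≤ ∫ t, ‖g t‖ ^ 2 ∂μ := integral_nonneg fun t => by positivity
  rw [hg.eLpNorm_eq_integral_rpow_norm (by norm_num) (by norm_num)]
  simp only [ENNReal.toReal_ofNat, Real.rpow_two]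
  rw [ENNReal.toReal_ofReal (by positivity), ← Real.rpow_natCast, ← Real.rpow_mul hnn]
  norm_num

/-- Bernstein's inequality in `L²`. -/
theorem integral_norm_sq_iteratedDeriv_bandExt_le {a : ℝ} {φ : ℝ → ℂ}
    (hφ : MemLp φ 2 (volume.restrict (Set.Icc (-a) a))) (l : ℕ) :
    MemLp (fun t : ℝ => iteratedDeriv l (bandExt a φ) t) 2 volume ∧
      ∫ t : ℝ, ‖iteratedDeriv l (bandExt a φ) t‖ ^ 2 ≤
        (2 * Real.pi * a) ^ (2 * l) * ∫ t : ℝ, ‖bandExt a φ t‖ ^ 2 := by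
  have hI : IntegrableOn φ (Set.Icc (-a) a) := hφ.integrable (by norm_num)
  have hφl : MemLp (fun w : ℝ => (2 * Real.pi * Complex.I * w) ^ l * φ w) 2
      (volume.restrict (Set.Icc (-a) a)) := by
    refine hφ.of_le_mul (c := (2 * Real.pi * a) ^ l) ?_ ?_
    · exact (by fun_prop : Continuous fun w : ℝ =>
        (2 * Real.pi * Complex.I * w) ^ l).aestronglyMeasurable.mul hφ.1
    · filter_upwards [ae_restrict_mem measurableSet_Icc] with w hw
      rw [norm_mul, norm_pow]
      gcongr
      simp only [Complex.norm_mul, Complex.norm_ofNat, Complex.norm_real, Complex.norm_I,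
        Real.norm_eq_abs, abs_of_pos Real.pi_pos, mul_one]
      gcongr
      exact abs_le.2 hw
  rw [iteratedDeriv_bandExt hI]
  refine ⟨(memLp_bandExt hφl).1, ?_⟩
  rw [integral_norm_sq_eq_eLpNorm (memLp_bandExt hφl).1, (memLp_bandExt hφl).2,
    ← integral_norm_sq_eq_eLpNorm hφl, integral_norm_sq_eq_eLpNorm (memLp_bandExt hφ).1,
    (memLp_bandExt hφ).2, ← integral_norm_sq_eq_eLpNorm hφ, ← integral_const_mul]
  refine integral_mono_ae ((memLp_two_iff_integrable_sq_norm hφl.1).1 hφl)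
    (((memLp_two_iff_integrable_sq_norm hφ.1).1 hφ).const_mul _) ?_
  filter_upwards [ae_restrict_mem measurableSet_Icc] with w hw
  have h1 : ‖(2 * Real.pi * Complex.I * w : ℂ)‖ ≤ 2 * Real.pi * a := by
    simp only [Complex.norm_mul, Complex.norm_ofNat, Complex.norm_real, Complex.norm_I,
      Real.norm_eq_abs, abs_of_pos Real.pi_pos, mul_one]
    gcongr
    exact abs_le.2 hw
  rw [norm_mul, norm_pow, mul_pow, ← pow_mul, mul_comm l 2]
  gcongr

/-- The upper frame bound. -/
theorem tsum_sq_iteratedDeriv_bandExt_le {a : ℝ} (k : ℕ)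
    {x : ℤ → ℝ} {γ : ℝ} (hγ : 0 < γ) (hsep : SeparatedBy x γ) :
    ∃ B : ℝ, 0 < B ∧ ∀ φ : ℝ → ℂ, MemLp φ 2 (volume.restrict (Set.Icc (-a) a)) →
      Summable (fun i => ∑ l ∈ Finset.range k, ‖iteratedDeriv l (bandExt a φ) (x i : ℂ)‖ ^ 2) ∧
      ∑' i, ∑ l ∈ Finset.range k, ‖iteratedDeriv l (bandExt a φ) (x i : ℂ)‖ ^ 2 ≤
        B * ∫ t : ℝ, ‖bandExt a φ t‖ ^ 2 := by
  set c : ℕ → ℝ := fun l => (2 * Real.pi * a) ^ (2 * l) with hc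
  have hcnn : ∀ l, 0 ≤ c l := fun l => by simp only [hc, pow_mul]; positivity
  -- Sobolev's constant times the Bernstein constants of orders `l` and `l + 1`; the final `1` gives
  -- positivity whatever `k` and `a` are.
  refine ⟨∑ l ∈ Finset.range k, (1 / γ + 1) * (c l + c (l + 1)) + 1, ?_, fun φ hφ => ?_⟩
  · have : 0 ≤ ∑ l ∈ Finset.range k, (1 / γ + 1) * (c l + c (l + 1)) :=
      Finset.sum_nonneg fun l _ => mul_nonneg (by positivity) (add_nonneg (hcnn _) (hcnn _))
    linarith
  have hI : IntegrableOn φ (Set.Icc (-a) a) := hφ.integrable (by norm_num)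
  have hd := differentiable_bandExt hI
  set N := ∫ t : ℝ, ‖bandExt a φ t‖ ^ 2 with hN
  have hNnn : 0 ≤ N := integral_nonneg fun t => by positivity
  have key : ∀ l, Summable (fun i => ‖iteratedDeriv l (bandExt a φ) (x i : ℂ)‖ ^ 2) ∧
      ∑' i, ‖iteratedDeriv l (bandExt a φ) (x i : ℂ)‖ ^ 2 ≤
        (1 / γ + 1) * (c l + c (l + 1)) * N := by
    intro l
    have b1 := integral_norm_sq_iteratedDeriv_bandExt_le hφ l
    have b2 := integral_norm_sq_iteratedDeriv_bandExt_le hφ (l + 1)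
    have hs := summable_norm_sq_of_separatedBy
      (G := fun t : ℝ => iteratedDeriv l (bandExt a φ) t)
      (G' := fun t : ℝ => iteratedDeriv (l + 1) (bandExt a φ) t)
      (fun t => by
        rw [iteratedDeriv_succ]
        exact (hd.differentiable_iteratedDeriv_complex l).differentiableAt.hasDerivAt.comp_ofReal)
      ((hd.differentiable_iteratedDeriv_complex (l + 1)).continuous.comp Complex.continuous_ofReal)
      b1.1 b2.1 hγ hsep
    refine ⟨hs.1, hs.2.trans ?_⟩
    rw [mul_assoc, add_mul (c l)]
    exact mul_le_mul_of_nonneg_left (add_le_add b1.2 b2.2) (by positivity)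
  refine ⟨summable_sum fun l _ => (key l).1, ?_⟩
  rw [Summable.tsum_finsetSum fun l _ => (key l).1, add_mul, Finset.sum_mul]
  have : ∑ l ∈ Finset.range k, ∑' i, ‖iteratedDeriv l (bandExt a φ) (x i : ℂ)‖ ^ 2 ≤
      ∑ l ∈ Finset.range k, (1 / γ + 1) * (c l + c (l + 1)) * N :=
    Finset.sum_le_sum fun l _ => (key l).2
  linarith

/-! ### The lower frame bound. -/

/-- Leibniz' rule and the Cauchy–Schwarz inequality. -/
theorem norm_sq_iteratedDeriv_mul_le {k l : ℕ} (hl : l < k) {f g : ℂ → ℂ}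
    (hf : Differentiable ℂ f) (hg : Differentiable ℂ g) (z : ℂ) :
    ‖iteratedDeriv l (fun w => f w * g w) z‖ ^ 2 ≤
      4 ^ k * ((∑ j ∈ Finset.range k, ‖iteratedDeriv j f z‖ ^ 2) *
        ∑ j ∈ Finset.range k, ‖iteratedDeriv j g z‖ ^ 2) := by
  have hle : ∀ (h : ℂ → ℂ) (j : ℕ), j < k → ‖iteratedDeriv j h z‖ ≤
      √(∑ j ∈ Finset.range k, ‖iteratedDeriv j h z‖ ^ 2) := by
    intro h j hj
    refine Real.le_sqrt_of_sq_le ?_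
    exact Finset.single_le_sum (f := fun j => ‖iteratedDeriv j h z‖ ^ 2)
      (fun _ _ => by positivity) (Finset.mem_range.2 hj)
  set P := ∑ j ∈ Finset.range k, ‖iteratedDeriv j f z‖ ^ 2 with hP
  set Q := ∑ j ∈ Finset.range k, ‖iteratedDeriv j g z‖ ^ 2 with hQ
  have hPnn : 0 ≤ P := Finset.sum_nonneg fun _ _ => by positivity
  have hQnn : 0 ≤ Q := Finset.sum_nonneg fun _ _ => by positivity
  have h1 : ‖iteratedDeriv l (fun w => f w * g w) z‖ ≤ 2 ^ k * (√P * √Q) := by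
    rw [iteratedDeriv_fun_mul hf.contDiff.contDiffAt hg.contDiff.contDiffAt]
    refine (norm_sum_le _ _).trans ?_
    calc _ ≤ ∑ i ∈ Finset.range (l + 1), (l.choose i : ℝ) * (√P * √Q) := by
          refine Finset.sum_le_sum fun i hi => ?_
          rw [Finset.mem_range] at hi
          rw [norm_mul, norm_mul, mul_assoc, Complex.norm_natCast]
          gcongr
          · exact hle f i (by omega)
          · exact hle g (l - i) (by omega)
      _ = 2 ^ l * (√P * √Q) := by
          rw [← Finset.sum_mul, ← Nat.cast_sum, Nat.sum_range_choose]; norm_num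
      _ ≤ 2 ^ k * (√P * √Q) := by
          gcongr
          norm_num
  calc _ ≤ (2 ^ k * (√P * √Q)) ^ 2 := by gcongr
    _ = 4 ^ k * (P * Q) := by
      rw [mul_pow, mul_pow, Real.sq_sqrt hPnn, Real.sq_sqrt hQnn, ← pow_mul, mul_comm k 2, pow_mul]
      norm_num

/-- The lower frame bound. -/
theorem integral_norm_sq_bandExt_le_tsum {k : ℕ} (hk : 1 ≤ k) {σ : ℝ} (hσ : 0 < σ)
    {x : ℤ → ℝ} (hx : StrictMono x) {γ : ℝ} (hγ : 0 < γ) (hsep : SeparatedBy x γ)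
    {ν : ℕ} (hν : 1 ≤ ν) {δ : ℝ} (hδ : ∀ i : ℤ, x (i + (ν : ℤ)) - x i ≤ δ)
    (hlt : σ * (δ / ν) < k * Real.pi) :
    ∃ C : ℝ, 0 < C ∧ ∀ φ : ℝ → ℂ,
      MemLp φ 2 (volume.restrict (Set.Icc (-(σ / (2 * Real.pi))) (σ / (2 * Real.pi)))) →
      Summable (fun i => ∑ l ∈ Finset.range k,
        ‖iteratedDeriv l (bandExt (σ / (2 * Real.pi)) φ) (x i : ℂ)‖ ^ 2) →
      ∫ t : ℝ, ‖bandExt (σ / (2 * Real.pi)) φ t‖ ^ 2 ≤ C * ∑' i, ∑ l ∈ Finset.range k,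
        ‖iteratedDeriv l (bandExt (σ / (2 * Real.pi)) φ) (x i : ℂ)‖ ^ 2 := by
  have hνpos : (0:ℝ) < ν := by exact_mod_cast hν
  have hδpos : 0 < δ := by
    have h1 := hδ 0
    have h2 : x 0 < x (0 + (ν:ℤ)) := hx (by omega)
    linarith
  have hpi := Real.pi_pos
  set a := σ / (2 * Real.pi) with ha
  have haσ : 2 * Real.pi * a = σ := by rw [ha]; field_simp
  set d := δ / ν with hd
  have hdpos : 0 < d := by positivity
  -- Half of the available slack: `(σ + ε) d` is the midpoint of `σ d` and `k π`.
  obtain ⟨ε, hε, hεlt⟩ : ∃ ε : ℝ, 0 < ε ∧ (σ + ε) * d < k * Real.pi := by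
    refine ⟨(k * Real.pi - σ * d) / (2 * d), div_pos (by linarith) (by positivity), ?_⟩
    have : (σ + (k * Real.pi - σ * d) / (2 * d)) * d = (σ * d + k * Real.pi) / 2 := by
      field_simp; ring
    rw [this]; linarith
  set b := ε / (2 * Real.pi) with hb
  have hbpos : 0 < b := by positivity
  have hbε : 2 * Real.pi * b = ε := by rw [hb]; field_simp
  obtain ⟨K, hK, hsamp⟩ := exists_norm_le_mul_of_samples hk (by positivity : 0 ≤ σ + ε)
    hx hγ hsep hν hδ hεlt
  -- a multiplier of small exponential type
  set m : ℝ → ℂ := fun _ => ((1 / (2 * b) : ℝ) : ℂ) with hm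
  have hm2 : MemLp m 2 (volume.restrict (Set.Icc (-b) b)) := memLp_const _
  have hmI : IntegrableOn m (Set.Icc (-b) b) := hm2.integrable (by norm_num)
  have hΨd := differentiable_bandExt hmI
  set Ψ := bandExt b m with hΨ
  have hΨ0 : Ψ 0 = 1 := by
    rw [hΨ, bandExt]
    simp only [mul_zero, Complex.exp_zero, mul_one, hm]
    rw [setIntegral_const, Measure.real, Real.volume_Icc,
      ENNReal.toReal_ofReal (by linarith), Complex.real_smul, ← Complex.ofReal_mul]
    have : (b - -b) * (1 / (2 * b)) = 1 := by field_simp; ring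
    rw [this, Complex.ofReal_one]
  set P : ℝ → ℝ := fun t => ∑ j ∈ Finset.range k, ‖iteratedDeriv j Ψ (t : ℂ)‖ ^ 2 with hP
  have hPnn : ∀ t, 0 ≤ P t := fun t => Finset.sum_nonneg fun _ _ => by positivity
  have hPint : Integrable P := by
    refine integrable_finsetSum _ fun j _ => ?_
    have := (integral_norm_sq_iteratedDeriv_bandExt_le hm2 j).1
    exact (memLp_two_iff_integrable_sq_norm this.1).1 this
  have hPcont : Continuous P := by
    refine continuous_finsetSum _ fun j _ => ?_
    exact (((hΨd.differentiable_iteratedDeriv_complex j).continuous.comp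
      Complex.continuous_ofReal).norm).pow 2
  obtain ⟨D, hD⟩ : ∃ D, ∀ t, P t ≤ D := by
    refine ⟨∑ j ∈ Finset.range k, (∫ w in Set.Icc (-b) b,
      ‖(2 * Real.pi * Complex.I * w) ^ j * m w‖) ^ 2, fun t => Finset.sum_le_sum fun j _ => ?_⟩
    rw [hΨ, iteratedDeriv_bandExt hmI]
    have := norm_bandExt_le (integrableOn_pow_mul hmI j) (t : ℂ)
    simp only [Complex.ofReal_im, abs_zero, mul_zero, Real.exp_zero, mul_one] at this
    gcongr
  set J := ∫ t, P t with hJ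
  have hJnn : 0 ≤ J := integral_nonneg hPnn
  refine ⟨K ^ 2 * 4 ^ k * J + 1, by positivity, fun φ hφ hsum => ?_⟩
  have hφI : IntegrableOn φ (Set.Icc (-a) a) := hφ.integrable (by norm_num)
  have hΦd := differentiable_bandExt hφI
  set Φ := bandExt a φ with hΦ
  set G : ℤ → ℝ := fun i => ∑ l ∈ Finset.range k, ‖iteratedDeriv l Φ (x i : ℂ)‖ ^ 2 with hG
  have hGnn : ∀ i, 0 ≤ G i := fun i => Finset.sum_nonneg fun _ _ => by positivity
  have hGP : ∀ y, Summable fun i => G i * P (x i - y) := fun y =>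
    Summable.of_nonneg_of_le (fun i => mul_nonneg (hGnn i) (hPnn _))
      (fun i => mul_le_mul_of_nonneg_left (hD _) (hGnn i)) (hsum.mul_right D)
  -- Supremum-norm sampling for `Φ(z) Ψ(z - y)`, whose value at `z = y` is `Φ y`. By Leibniz its
  -- squared samples at `x i` are at most `4^k G i P(x i - y)`, and a single term is bounded by the
  -- whole sum.
  have hpoint : ∀ y : ℝ, ‖Φ y‖ ^ 2 ≤ K ^ 2 * 4 ^ k * ∑' i, G i * P (x i - y) := by
    intro y
    set T := ∑' i, G i * P (x i - y) with hT
    have hTnn : 0 ≤ T := tsum_nonneg fun i => mul_nonneg (hGnn i) (hPnn _)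
    have hΨyd : Differentiable ℂ fun z : ℂ => Ψ (z - y) :=
      hΨd.comp (differentiable_id.sub_const _)
    have h := hsamp (fun z => Φ z * Ψ (z - y))
      ((∫ w in Set.Icc (-a) a, ‖φ w‖) * ∫ w in Set.Icc (-b) b, ‖m w‖) (√(4 ^ k * T))
      (hΦd.mul hΨyd) (fun z => ?_) (fun i l hl => ?_) y
    · simp only [sub_self, hΨ0, mul_one] at h
      calc _ ≤ (K * √(4 ^ k * T)) ^ 2 := by gcongr
        _ = _ := by rw [mul_pow, Real.sq_sqrt (by positivity), mul_assoc]
    · rw [norm_mul]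
      have h1 := norm_bandExt_le hφI z
      have h2 := norm_bandExt_le hmI (z - y)
      rw [haσ] at h1
      rw [hbε, Complex.sub_im, Complex.ofReal_im, sub_zero] at h2
      rw [add_mul, Real.exp_add]
      calc _ ≤ ((∫ w in Set.Icc (-a) a, ‖φ w‖) * Real.exp (σ * |z.im|)) *
            ((∫ w in Set.Icc (-b) b, ‖m w‖) * Real.exp (ε * |z.im|)) := by gcongr
        _ = _ := by ring
    · refine Real.le_sqrt_of_sq_le ((norm_sq_iteratedDeriv_mul_le hl hΦd hΨyd _).trans ?_)
      gcongr
      refine le_trans (le_of_eq ?_) ((hGP y).le_tsum i fun j _ =>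
        mul_nonneg (hGnn j) (hPnn _))
      congr 1
      refine Finset.sum_congr rfl fun j _ => ?_
      rw [iteratedDeriv_comp_sub_const]
      push_cast
      rfl
  -- integrate over `y`
  have hS : 0 ≤ ∑' i, G i := tsum_nonneg hGnn
  have hΦ2 := (memLp_bandExt hφ).1
  have hΦi : Integrable fun t : ℝ => ‖Φ t‖ ^ 2 := (memLp_two_iff_integrable_sq_norm hΦ2.1).1 hΦ2
  have hmain : ∫ t : ℝ, ‖Φ t‖ ^ 2 ≤ K ^ 2 * 4 ^ k * (∑' i, G i * J) := by
    have hsh : ∀ i, ∫ y, P (x i - y) = J := fun i => integral_sub_left_eq_self P volume (x i)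
    have hshi : ∀ i, Integrable fun y => P (x i - y) := fun i => hPint.comp_sub_left (x i)
    -- In `ENNReal` the sum and the integral commute without prior integrability of the sum.
    have hL : ∫⁻ t : ℝ, ENNReal.ofReal (‖Φ t‖ ^ 2) ≤
        ENNReal.ofReal (K ^ 2 * 4 ^ k * (∑' i, G i * J)) := by
      calc _ ≤ ∫⁻ y, ENNReal.ofReal (K ^ 2 * 4 ^ k) *
            ∑' i, ENNReal.ofReal (G i * P (x i - y)) := by
            refine lintegral_mono fun y => ?_
            rw [← ENNReal.ofReal_tsum_of_nonneg (fun i => mul_nonneg (hGnn i) (hPnn _)) (hGP y),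
              ← ENNReal.ofReal_mul (by positivity)]
            exact ENNReal.ofReal_le_ofReal (hpoint y)
        _ = ENNReal.ofReal (K ^ 2 * 4 ^ k) * ∑' i, ENNReal.ofReal (G i * J) := by
            have hmeas : ∀ i, Measurable fun y => ENNReal.ofReal (G i * P (x i - y)) := fun i =>
              (by fun_prop : Continuous fun y => G i * P (x i - y)).measurable.ennreal_ofReal
            rw [lintegral_const_mul _ (Measurable.tsum hmeas),
              lintegral_tsum fun i => (hmeas i).aemeasurable]
            congr 2
            ext i
            rw [← ofReal_integral_eq_lintegral_ofReal ((hshi i).const_mul _)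
              (Filter.Eventually.of_forall fun y => mul_nonneg (hGnn i) (hPnn _)),
              integral_const_mul, hsh]
        _ = _ := by
            rw [← ENNReal.ofReal_tsum_of_nonneg (fun i => mul_nonneg (hGnn i) hJnn)
              (hsum.mul_right J), ← ENNReal.ofReal_mul (by positivity)]
    rw [← ofReal_integral_eq_lintegral_ofReal hΦi
      (Filter.Eventually.of_forall fun y => by positivity)] at hL
    refine (ENNReal.ofReal_le_ofReal_iff ?_).1 hL
    exact mul_nonneg (by positivity) (tsum_nonneg fun i => mul_nonneg (hGnn i) hJnn)
  rw [tsum_mul_right] at hmain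
  have : (K ^ 2 * 4 ^ k * J + 1) * ∑' i, G i =
      K ^ 2 * 4 ^ k * ((∑' i, G i) * J) + ∑' i, G i := by ring
  linarith

/-- Derivative sampling for bandlimited functions above the critical density. -/
theorem sampling_with_derivatives_of_density {k : ℕ} (hk : 1 ≤ k) {σ : ℝ} (hσ : 0 < σ)
    {x : ℤ → ℝ} (hx : StrictMono x) {γ : ℝ} (hγ : 0 < γ) (hsep : SeparatedBy x γ)
    {ν : ℕ} (hν : 1 ≤ ν) {δ : ℝ} (hδ : ∀ i : ℤ, x (i + (ν : ℤ)) - x i ≤ δ)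
    (hlt : σ * (δ / ν) < k * Real.pi) :
    ∃ A B : ℝ, 0 < A ∧ 0 < B ∧
      ∀ f ∈ Bandlimited σ,
        ∃ F : ℝ → ℂ, ContDiff ℝ ∞ F ∧ F =ᵐ[volume] f ∧
          Summable (fun i : ℤ => ∑ l ∈ Finset.range k, ‖iteratedDeriv l F (x i)‖ ^ 2) ∧
          A * ‖f‖ ^ 2 ≤ ∑' i : ℤ, ∑ l ∈ Finset.range k, ‖iteratedDeriv l F (x i)‖ ^ 2 ∧
          ∑' i : ℤ, ∑ l ∈ Finset.range k, ‖iteratedDeriv l F (x i)‖ ^ 2 ≤ B * ‖f‖ ^ 2 := by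
  obtain ⟨C, hC, hlow⟩ := integral_norm_sq_bandExt_le_tsum hk hσ hx hγ hsep hν hδ hlt
  obtain ⟨B, hB, hup⟩ := tsum_sq_iteratedDeriv_bandExt_le (a := σ / (2 * Real.pi)) k hγ hsep
  refine ⟨1 / C, B, by positivity, hB, fun f hf => ?_⟩
  set φ : ℝ → ℂ := fun w => (𝓕 f : Lp ℂ 2 (volume : Measure ℝ)) w with hφ
  have hφ2 : MemLp φ 2
      (volume.restrict (Set.Icc (-(σ / (2 * Real.pi))) (σ / (2 * Real.pi)))) :=
    (Lp.memLp _).restrict _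
  have hd := differentiable_bandExt (hφ2.integrable (by norm_num))
  have hae := Bandlimited.ae_eq_bandExt hf
  have hnorm : ∫ t : ℝ, ‖bandExt (σ / (2 * Real.pi)) φ t‖ ^ 2 = ‖f‖ ^ 2 := by
    rw [integral_norm_sq_eq_eLpNorm (memLp_bandExt hφ2).1, eLpNorm_congr_ae hae, Lp.norm_def]
  refine ⟨fun t => bandExt (σ / (2 * Real.pi)) φ t, ?_, hae, ?_⟩
  · exact (hd.contDiff.restrict_scalars ℝ).comp Complex.ofRealCLM.contDiff
  simp only [iteratedDeriv_comp_ofReal hd]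
  obtain ⟨h1, h2⟩ := hup φ hφ2
  have h3 := hlow φ hφ2 h1
  rw [hnorm] at h2 h3
  refine ⟨h1, ?_, h2⟩
  rw [one_div, inv_mul_le_iff₀ hC]
  exact h3

/-! ### Compact operators and the Volterra operator on `L²(0, 1)`. -/

/-- The norm of a nonzero positive compact operator is an eigenvalue. -/
theorem exists_eigenvector_of_isCompactOperator {E : Type*} [NormedAddCommGroup E]
    [InnerProductSpace ℝ E] [CompleteSpace E] {T : E →L[ℝ] E} (hc : IsCompactOperator T)
    (hs : (T : E →ₗ[ℝ] E).IsSymmetric) (hpos : ∀ x, 0 ≤ inner ℝ (T x) x) {x₀ : E}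
    (h₀ : 0 < inner ℝ (T x₀) x₀) :
    ∃ μ : ℝ, 0 < μ ∧ (∃ v, v ≠ 0 ∧ T v = μ • v) ∧ inner ℝ (T x₀) x₀ ≤ μ * ‖x₀‖ ^ 2 := by
  have hle : ∀ x, inner ℝ (T x) x ≤ ‖T‖ * ‖x‖ ^ 2 := by
    intro x
    calc inner ℝ (T x) x ≤ ‖T x‖ * ‖x‖ := real_inner_le_norm _ _
      _ ≤ ‖T‖ * ‖x‖ * ‖x‖ := by gcongr; exact T.le_opNorm x
      _ = _ := by ring
  have hTpos : 0 < ‖T‖ := by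
    rw [norm_pos_iff]
    rintro rfl
    simp at h₀
  have : Nontrivial E := by
    refine ⟨x₀, 0, ?_⟩
    rintro rfl
    simp at h₀
  refine ⟨‖T‖, hTpos, ?_, hle x₀⟩
  rcases hc.hasEigenvalue_or_mem_resolventSet hTpos.ne' with h | h
  · obtain ⟨v, hv⟩ := h.exists_hasEigenvector
    exact ⟨v, hv.2, Module.End.mem_eigenspace_iff.1 hv.1⟩
  -- If `‖T‖` were in the resolvent set, the Rayleigh quotient would stay below `‖T‖ - ε`, yet for
  -- symmetric `T` its supremum in absolute value is `‖T‖`.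
  · exfalso
    obtain ⟨ε, hε, hεle⟩ := T.rayleighQuotient_le_of_norm_mem_resolventSet h
    have h1 := T.norm_eq_iSup_rayleighQuotient hs
    have h2 : ⨆ x, |T.rayleighQuotient x| ≤ ‖T‖ - ε := by
      refine ciSup_le fun x => ?_
      rw [abs_of_nonneg]
      · exact hεle x
      · exact div_nonneg (hpos x) (by positivity)
    linarith

/-- Real `L²` on the unit interval. -/
noncomputable abbrev UnitIntervalL2 := Lp ℝ 2 (volume : Measure unitInterval)

/-- The integral operator with a kernel that is continuous with values in `L²`. -/
noncomputable def kernelBCF (κ : C(unitInterval, UnitIntervalL2)) :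
    UnitIntervalL2 →L[ℝ] BoundedContinuousFunction unitInterval ℝ :=
  LinearMap.mkContinuous
    { toFun := fun g => BoundedContinuousFunction.mkOfCompact
        ⟨fun t => inner ℝ (κ t) g, by fun_prop⟩
      map_add' := fun g h => by ext t; simp [inner_add_right]
      map_smul' := fun c g => by ext t; simp [inner_smul_right] }
    ‖κ‖ (fun g => by
      refine (BoundedContinuousFunction.norm_le (by positivity)).2 fun t => ?_
      refine (norm_inner_le_norm (𝕜 := ℝ) (κ t) g).trans ?_
      gcongr
      exact κ.norm_coe_le_norm t)

/-- The integral operator on `L²` with a kernel that is continuous with values in `L²`. -/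
noncomputable def kernelOp (κ : C(unitInterval, UnitIntervalL2)) :
    UnitIntervalL2 →L[ℝ] UnitIntervalL2 :=
  (BoundedContinuousFunction.toLp 2 volume ℝ) ∘L kernelBCF κ

theorem coeFn_kernelOp (κ : C(unitInterval, UnitIntervalL2)) (g : UnitIntervalL2) :
    (kernelOp κ g : unitInterval → ℝ) =ᵐ[volume] fun t => inner ℝ (κ t) g :=
  BoundedContinuousFunction.coeFn_toLp 2 volume ℝ (kernelBCF κ g)

/-- By Cauchy–Schwarz the image of the unit ball is bounded by `‖κ‖` and inherits the modulus of
continuity of `κ`, so Arzelà–Ascoli gives compactness in the supremum norm, which is finer than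
`L²`. -/
theorem isCompactOperator_kernelOp (κ : C(unitInterval, UnitIntervalL2)) :
    IsCompactOperator (kernelOp κ) := by
  suffices h : IsCompactOperator (kernelBCF κ) from
    h.clm_comp (BoundedContinuousFunction.toLp (E := ℝ) 2 (volume : Measure unitInterval) ℝ)
  refine (isCompactOperator_iff_isCompact_closure_image_closedBall
    (kernelBCF κ : UnitIntervalL2 →ₗ[ℝ] BoundedContinuousFunction unitInterval ℝ) one_pos).2 ?_
  refine BoundedContinuousFunction.arzela_ascoli (Metric.closedBall (0:ℝ) ‖κ‖)
    (isCompact_closedBall _ _) _ ?_ ?_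
  · rintro _ t ⟨g, hg, rfl⟩
    have hg' : ‖g‖ ≤ 1 := by simpa using hg
    rw [mem_closedBall_zero_iff]
    refine (norm_inner_le_norm (𝕜 := ℝ) (κ t) g).trans ?_
    have := mul_le_mul (κ.norm_coe_le_norm t) hg' (norm_nonneg _) (norm_nonneg _)
    simpa using this
  · intro t₀
    rw [Metric.equicontinuousAt_iff_right]
    intro ε hε
    filter_upwards [Metric.tendsto_nhds.1 (κ.continuous.tendsto t₀) ε hε] with t ht
    rintro ⟨_, g, hg, rfl⟩
    have hg' : ‖g‖ ≤ 1 := by simpa using hg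
    have e : dist (inner ℝ (κ t₀) g : ℝ) (inner ℝ (κ t) g) ≤ dist (κ t) (κ t₀) := by
      rw [dist_comm, dist_eq_norm, dist_eq_norm, ← inner_sub_left]
      refine (norm_inner_le_norm (𝕜 := ℝ) _ _).trans ?_
      exact mul_le_of_le_one_right (norm_nonneg _) hg'
    exact lt_of_le_of_lt e ht

/-- The indicator functions of the intervals `[0, t]`. -/
noncomputable def leftKernel : C(unitInterval, UnitIntervalL2) where
  toFun t := indicatorConstLp 2 (measurableSet_Iic (a := t)) (measure_ne_top _ _) (1 : ℝ)
  continuous_toFun := by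
    refine continuous_indicatorConstLp_set (by norm_num) fun t => ?_
    refine tendsto_of_tendsto_of_tendsto_of_le_of_le tendsto_const_nhds
      (h := fun y => edist t y) ?_ (fun _ => zero_le) (fun y => ?_)
    · have : Continuous fun y : unitInterval => edist t y := by fun_prop
      simpa using this.tendsto t
    · simp only
      rw [← unitInterval.volume_uIoc]
      refine measure_mono fun s hs => ?_
      rw [Set.mem_symmDiff] at hs
      simp only [Set.mem_Iic, not_le] at hs
      rw [Set.mem_uIoc]
      tauto

/-- The indicator functions of the intervals `[t, 1]`. -/
noncomputable def rightKernel : C(unitInterval, UnitIntervalL2) where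
  toFun t := indicatorConstLp 2 (measurableSet_Ici (a := t)) (measure_ne_top _ _) (1 : ℝ)
  continuous_toFun := by
    refine continuous_indicatorConstLp_set (by norm_num) fun t => ?_
    refine tendsto_of_tendsto_of_tendsto_of_le_of_le tendsto_const_nhds
      (h := fun y => edist t y) ?_ (fun _ => zero_le) (fun y => ?_)
    · have : Continuous fun y : unitInterval => edist t y := by fun_prop
      simpa using this.tendsto t
    · simp only
      rw [← unitInterval.volume_uIcc]
      refine measure_mono fun s hs => ?_
      rw [Set.mem_symmDiff] at hs
      simp only [Set.mem_Ici, not_le] at hs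
      rw [Set.mem_uIcc]
      rcases hs with h | h
      · exact Or.inl ⟨h.1, h.2.le⟩
      · exact Or.inr ⟨h.1, h.2.le⟩

theorem setIntegral_unitInterval (φ : ℝ → ℝ) (s : Set ℝ) (hs : MeasurableSet s) :
    ∫ t in ((↑) ⁻¹' s : Set unitInterval), φ t = ∫ t in s ∩ Set.Icc (0:ℝ) 1, φ t := by
  have h := (MeasurableEmbedding.subtype_coe (measurableSet_Icc (a := (0:ℝ)) (b := 1))).setIntegral_map
    (μ := (volume : Measure unitInterval)) φ s
  rw [unitInterval.volume_def, map_comap_subtype_coe measurableSet_Icc,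
    Measure.restrict_restrict hs] at h
  rw [unitInterval.volume_def]
  exact h.symm

theorem integral_Iic_unitInterval (φ : ℝ → ℝ) (t : unitInterval) :
    ∫ s in Set.Iic t, φ s = ∫ s in (0:ℝ)..t, φ s := by
  have h := setIntegral_unitInterval φ (Set.Iic (t:ℝ)) measurableSet_Iic
  have e : Set.Iic (t:ℝ) ∩ Set.Icc 0 1 = Set.Icc 0 (t:ℝ) := by
    ext s
    simp only [Set.mem_inter_iff, Set.mem_Iic, Set.mem_Icc]
    exact ⟨fun h => ⟨h.2.1, h.1⟩, fun h => ⟨h.2, h.1, h.2.trans t.2.2⟩⟩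
  rw [e, integral_Icc_eq_integral_Ioc, ← intervalIntegral.integral_of_le t.2.1] at h
  exact h

theorem integral_Ici_unitInterval (φ : ℝ → ℝ) (t : unitInterval) :
    ∫ s in Set.Ici t, φ s = ∫ s in (t:ℝ)..1, φ s := by
  have h := setIntegral_unitInterval φ (Set.Ici (t:ℝ)) measurableSet_Ici
  have e : Set.Ici (t:ℝ) ∩ Set.Icc 0 1 = Set.Icc (t:ℝ) 1 := by
    ext s
    simp only [Set.mem_inter_iff, Set.mem_Ici, Set.mem_Icc]
    exact ⟨fun h => ⟨h.1, h.2.2⟩, fun h => ⟨h.1, t.2.1.trans h.1, h.2⟩⟩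
  rw [e, integral_Icc_eq_integral_Ioc, ← intervalIntegral.integral_of_le t.2.2] at h
  exact h

theorem integral_unitInterval (φ : ℝ → ℝ) :
    ∫ s : unitInterval, φ s = ∫ s in (0:ℝ)..1, φ s := by
  have := integral_Iic_unitInterval φ 1
  rw [show Set.Iic (1 : unitInterval) = Set.univ from Set.Iic_top, setIntegral_univ] at this
  simpa using this

/-- `φ` represents `g` on the unit interval. -/
def Represents (φ : ℝ → ℝ) (g : UnitIntervalL2) : Prop :=
  (g : unitInterval → ℝ) =ᵐ[volume] fun s => φ s

theorem Represents.inner_eq {φ ψ : ℝ → ℝ} {f g : UnitIntervalL2} (hf : Represents φ f)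
    (hg : Represents ψ g) : inner ℝ f g = ∫ s in (0:ℝ)..1, φ s * ψ s := by
  rw [L2.inner_def, ← integral_unitInterval]
  refine integral_congr_ae ?_
  filter_upwards [hf, hg] with s h1 h2
  rw [h1, h2]
  simp [mul_comm]

theorem Represents.norm_sq_eq {φ : ℝ → ℝ} {f : UnitIntervalL2} (hf : Represents φ f) :
    ‖f‖ ^ 2 = ∫ s in (0:ℝ)..1, φ s ^ 2 := by
  rw [← real_inner_self_eq_norm_sq, hf.inner_eq hf]
  simp only [sq]

theorem Represents.add {φ ψ : ℝ → ℝ} {f g : UnitIntervalL2} (hf : Represents φ f)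
    (hg : Represents ψ g) : Represents (φ + ψ) (f + g) := by
  unfold Represents at *
  filter_upwards [hf, hg, Lp.coeFn_add f g] with s h1 h2 h3
  rw [h3, Pi.add_apply, h1, h2]; rfl

theorem Represents.smul {φ : ℝ → ℝ} {f : UnitIntervalL2} (hf : Represents φ f) (c : ℝ) :
    Represents (c • φ) (c • f) := by
  unfold Represents at *
  filter_upwards [hf, Lp.coeFn_smul c f] with s h1 h3
  rw [h3, Pi.smul_apply, h1]; rfl

theorem represents_zero : Represents 0 0 := by
  filter_upwards [Lp.coeFn_zero ℝ 2 (volume : Measure unitInterval)] with s h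
  rw [h]; rfl

theorem exists_represents_of_continuous {φ : ℝ → ℝ} (hφ : Continuous φ) :
    ∃ g : UnitIntervalL2, Represents φ g :=
  ⟨BoundedContinuousFunction.toLp 2 volume ℝ (BoundedContinuousFunction.mkOfCompact
    ⟨fun s : unitInterval => φ s, by fun_prop⟩),
    BoundedContinuousFunction.coeFn_toLp 2 volume ℝ _⟩

/-- The Volterra operator. -/
noncomputable def volterra : UnitIntervalL2 →L[ℝ] UnitIntervalL2 := kernelOp leftKernel

/-- The adjoint of the Volterra operator. -/
noncomputable def volterraAdj : UnitIntervalL2 →L[ℝ] UnitIntervalL2 := kernelOp rightKernel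

/-- The primitive vanishing at `0`. -/
noncomputable def leftPrim (φ : ℝ → ℝ) (t : ℝ) : ℝ := ∫ s in (0:ℝ)..t, φ s

/-- The negative of the primitive vanishing at `1`. -/
noncomputable def rightPrim (φ : ℝ → ℝ) (t : ℝ) : ℝ := ∫ s in t..(1:ℝ), φ s

theorem hasDerivAt_leftPrim {φ : ℝ → ℝ} (hφ : Continuous φ) (t : ℝ) :
    HasDerivAt (leftPrim φ) (φ t) t :=
  intervalIntegral.integral_hasDerivAt_right (hφ.intervalIntegrable _ _)
    (hφ.stronglyMeasurableAtFilter _ _) hφ.continuousAt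

theorem hasDerivAt_rightPrim {φ : ℝ → ℝ} (hφ : Continuous φ) (t : ℝ) :
    HasDerivAt (rightPrim φ) (-φ t) t :=
  intervalIntegral.integral_hasDerivAt_left (hφ.intervalIntegrable _ _)
    (hφ.stronglyMeasurableAtFilter _ _) hφ.continuousAt

theorem deriv_leftPrim {φ : ℝ → ℝ} (hφ : Continuous φ) : deriv (leftPrim φ) = φ :=
  funext fun t => (hasDerivAt_leftPrim hφ t).deriv

theorem deriv_rightPrim {φ : ℝ → ℝ} (hφ : Continuous φ) : deriv (rightPrim φ) = -φ :=
  funext fun t => (hasDerivAt_rightPrim hφ t).deriv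

theorem Represents.inner_leftKernel {φ : ℝ → ℝ} {g : UnitIntervalL2} (hg : Represents φ g)
    (t : unitInterval) : inner ℝ (leftKernel t) g = leftPrim φ t := by
  rw [leftPrim, ← integral_Iic_unitInterval]
  refine (L2.inner_indicatorConstLp_one (𝕜 := ℝ) (measurableSet_Iic (a := t))
    (measure_ne_top _ _) g).trans ?_
  exact integral_congr_ae (ae_restrict_of_ae hg)

theorem Represents.inner_rightKernel {φ : ℝ → ℝ} {g : UnitIntervalL2} (hg : Represents φ g)
    (t : unitInterval) : inner ℝ (rightKernel t) g = rightPrim φ t := by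
  rw [rightPrim, ← integral_Ici_unitInterval]
  refine (L2.inner_indicatorConstLp_one (𝕜 := ℝ) (measurableSet_Ici (a := t))
    (measure_ne_top _ _) g).trans ?_
  exact integral_congr_ae (ae_restrict_of_ae hg)

theorem Represents.volterra {φ : ℝ → ℝ} {g : UnitIntervalL2} (hg : Represents φ g) :
    Represents (leftPrim φ) (volterra g) :=
  (coeFn_kernelOp _ g).trans (Filter.Eventually.of_forall fun t => hg.inner_leftKernel t)

theorem Represents.volterraAdj {φ : ℝ → ℝ} {g : UnitIntervalL2} (hg : Represents φ g) :
    Represents (rightPrim φ) (volterraAdj g) :=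
  (coeFn_kernelOp _ g).trans (Filter.Eventually.of_forall fun t => hg.inner_rightKernel t)

/-- For continuous functions this is integration by parts: one primitive vanishes at `0`, the other
at `1`. Density does the rest. -/
theorem inner_volterra (f g : UnitIntervalL2) :
    inner ℝ (volterra f) g = inner ℝ f (volterraAdj g) := by
  have hd := BoundedContinuousFunction.toLp_denseRange ℝ (volume : Measure unitInterval)
    (p := 2) ℝ (by norm_num)
  refine hd.induction_on₂ (p := fun f g => inner ℝ (volterra f) g = inner ℝ f (volterraAdj g))
    ?_ ?_ f g
  · exact isClosed_eq (by fun_prop) (by fun_prop)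
  · intro F G
    have hex : ∀ F : BoundedContinuousFunction unitInterval ℝ, ∃ φ : ℝ → ℝ, Continuous φ ∧
        Represents φ (BoundedContinuousFunction.toLp 2 volume ℝ F) := by
      intro F
      refine ⟨fun t => F (Set.projIcc 0 1 zero_le_one t), by fun_prop, ?_⟩
      filter_upwards [BoundedContinuousFunction.coeFn_toLp 2 volume ℝ F] with s hs
      rw [hs, Set.projIcc_val]
    obtain ⟨φ, hφ, hF⟩ := hex F
    obtain ⟨ψ, hψ, hG⟩ := hex G
    rw [hF.volterra.inner_eq hG, hF.inner_eq hG.volterraAdj]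
    have := intervalIntegral.integral_mul_deriv_eq_deriv_mul (a := 0) (b := 1)
      (u := leftPrim φ) (v := rightPrim ψ) (u' := φ) (v' := fun t => -ψ t)
      (fun t _ => hasDerivAt_leftPrim hφ t) (fun t _ => hasDerivAt_rightPrim hψ t)
      (hφ.intervalIntegrable _ _) (hψ.neg.intervalIntegrable _ _)
    simp only [mul_neg, intervalIntegral.integral_neg] at this
    have h0 : leftPrim φ 0 = 0 := by simp [leftPrim]
    have h1 : rightPrim ψ 1 = 0 := by simp [rightPrim]
    rw [h0, h1] at this
    linarith

theorem inner_volterra_pow (n : ℕ) (f g : UnitIntervalL2) :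
    inner ℝ ((volterra ^ n) f) g = inner ℝ f ((volterraAdj ^ n) g) := by
  induction n generalizing f g with
  | zero => simp
  | succ n ih =>
    rw [pow_succ, pow_succ', mul_apply_eq_comp, mul_apply_eq_comp, ih,
      inner_volterra]

theorem Represents.volterra_pow {φ : ℝ → ℝ} {g : UnitIntervalL2} (hg : Represents φ g) (n : ℕ) :
    Represents (leftPrim^[n] φ) ((_root_.volterra ^ n) g) := by
  induction n with
  | zero => simpa using hg
  | succ n ih =>
    rw [pow_succ', mul_apply_eq_comp, Function.iterate_succ_apply']
    exact ih.volterra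

theorem Represents.volterraAdj_pow {φ : ℝ → ℝ} {g : UnitIntervalL2} (hg : Represents φ g)
    (n : ℕ) : Represents (rightPrim^[n] φ) ((_root_.volterraAdj ^ n) g) := by
  induction n with
  | zero => simpa using hg
  | succ n ih =>
    rw [pow_succ', mul_apply_eq_comp, Function.iterate_succ_apply']
    exact ih.volterraAdj

theorem contDiff_leftPrim {φ : ℝ → ℝ} {n : ℕ} (hφ : ContDiff ℝ n φ) :
    ContDiff ℝ (n + 1 : ℕ) (leftPrim φ) := by
  push_cast
  refine contDiff_succ_iff_deriv.2 ⟨fun t => (hasDerivAt_leftPrim hφ.continuous t).differentiableAt,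
    fun h => by simp at h, ?_⟩
  rwa [deriv_leftPrim hφ.continuous]

theorem contDiff_rightPrim {φ : ℝ → ℝ} {n : ℕ} (hφ : ContDiff ℝ n φ) :
    ContDiff ℝ (n + 1 : ℕ) (rightPrim φ) := by
  push_cast
  refine contDiff_succ_iff_deriv.2
    ⟨fun t => (hasDerivAt_rightPrim hφ.continuous t).differentiableAt, fun h => by simp at h, ?_⟩
  rw [deriv_rightPrim hφ.continuous]
  exact hφ.neg

theorem contDiff_iterate_leftPrim {φ : ℝ → ℝ} {n : ℕ} (hφ : ContDiff ℝ n φ) (m : ℕ) :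
    ContDiff ℝ (n + m : ℕ) (leftPrim^[m] φ) := by
  induction m with
  | zero => simpa using hφ
  | succ m ih =>
    rw [Function.iterate_succ_apply']
    exact contDiff_leftPrim ih

theorem contDiff_iterate_rightPrim {φ : ℝ → ℝ} {n : ℕ} (hφ : ContDiff ℝ n φ) (m : ℕ) :
    ContDiff ℝ (n + m : ℕ) (rightPrim^[m] φ) := by
  induction m with
  | zero => simpa using hφ
  | succ m ih =>
    rw [Function.iterate_succ_apply']
    exact contDiff_rightPrim ih

theorem continuous_iterate_leftPrim {φ : ℝ → ℝ} (hφ : Continuous φ) (m : ℕ) :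
    Continuous (leftPrim^[m] φ) :=
  (contDiff_iterate_leftPrim (n := 0) (by simpa using hφ) m).continuous

theorem continuous_iterate_rightPrim {φ : ℝ → ℝ} (hφ : Continuous φ) (m : ℕ) :
    Continuous (rightPrim^[m] φ) :=
  (contDiff_iterate_rightPrim (n := 0) (by simpa using hφ) m).continuous

theorem iteratedDeriv_iterate_leftPrim {φ : ℝ → ℝ} (hφ : Continuous φ) (l m : ℕ) :
    iteratedDeriv l (leftPrim^[m + l] φ) = leftPrim^[m] φ := by
  induction l with
  | zero => simp
  | succ l ih =>
    rw [iteratedDeriv_succ', ← add_assoc, Function.iterate_succ_apply',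
      deriv_leftPrim (continuous_iterate_leftPrim hφ _), ih]

theorem iteratedDeriv_iterate_rightPrim {φ : ℝ → ℝ} (hφ : Continuous φ) (m : ℕ) :
    iteratedDeriv m (rightPrim^[m] φ) = (-1 : ℝ) ^ m • φ := by
  induction m with
  | zero => simp
  | succ m ih =>
    rw [iteratedDeriv_succ', Function.iterate_succ_apply',
      deriv_rightPrim (continuous_iterate_rightPrim hφ _)]
    ext t
    rw [iteratedDeriv_neg, ih, pow_succ]
    simp

/-! ### The boundary value problem as a spectral problem. -/

/-- The Rayleigh quotient of an admissible function bounds some eigenvalue from above. -/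
theorem exists_isWirtingerEigenvalue_mul_le {k : ℕ} (hk : 1 ≤ k) {φ₀ : ℝ → ℝ}
    (hφ₀ : Continuous φ₀) (hbd : ∀ j < k, leftPrim^[j + 1] φ₀ 1 = 0)
    (hne : 0 < ∫ s in (0:ℝ)..1, (leftPrim^[k] φ₀ s) ^ 2) :
    ∃ lam : ℝ, IsWirtingerEigenvalue k lam ∧
      lam * ∫ s in (0:ℝ)..1, (leftPrim^[k] φ₀ s) ^ 2 ≤ ∫ s in (0:ℝ)..1, φ₀ s ^ 2 := by
  obtain ⟨g₀, hg₀⟩ := exists_represents_of_continuous hφ₀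
  obtain ⟨e, he⟩ := exists_represents_of_continuous (φ := fun _ => (1:ℝ)) continuous_const
  -- Since `V*^j 1 = (1 - t)^j / j!`, the boundary conditions at `1` say that the `k`-th derivative
  -- is orthogonal to all polynomials of degree less than `k`; these form `Q`.
  have hmoment : ∀ (j : ℕ) {φ : ℝ → ℝ} {g : UnitIntervalL2}, Represents φ g →
      inner ℝ ((volterraAdj ^ j) e) g = leftPrim^[j + 1] φ 1 := by
    intro j φ g hg
    rw [real_inner_comm, ← inner_volterra_pow, (hg.volterra_pow j).inner_eq he,
      Function.iterate_succ_apply', leftPrim]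
    simp
  set Q : Submodule ℝ UnitIntervalL2 :=
    Submodule.span ℝ (Set.range fun j : Fin k => (volterraAdj ^ (j : ℕ)) e) with hQ
  have : FiniteDimensional ℝ Q := FiniteDimensional.span_of_finite ℝ (Set.finite_range _)
  have hQrep : ∀ q ∈ Q, ∃ ψ : ℝ → ℝ, ContDiff ℝ k ψ ∧ iteratedDeriv k ψ = 0 ∧
      Represents ψ q := by
    intro q hq
    induction hq using Submodule.span_induction with
    | mem q hq =>
      obtain ⟨⟨j, hj⟩, rfl⟩ := hq
      refine ⟨rightPrim^[j] fun _ => 1, ?_, ?_, he.volterraAdj_pow j⟩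
      · exact (contDiff_iterate_rightPrim (n := k) contDiff_const j).of_le (by
          exact_mod_cast Nat.le_add_right k j)
      · obtain ⟨m, hm⟩ := Nat.exists_eq_add_of_lt hj
        rw [show k = (m + 1) + j by omega, iteratedDeriv_eq_iterate,
          Function.iterate_add_apply, ← iteratedDeriv_eq_iterate, ← iteratedDeriv_eq_iterate,
          iteratedDeriv_iterate_rightPrim continuous_const]
        ext t
        have : ((-1 : ℝ) ^ (j : ℕ) • fun _ : ℝ => (1:ℝ)) = fun _ => (-1 : ℝ) ^ (j : ℕ) := by
          ext; simp
        rw [this, iteratedDeriv_const]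
        simp
    | zero => exact ⟨0, contDiff_const, by ext; simp, represents_zero⟩
    | add p q _ _ hp hq =>
      obtain ⟨ψ₁, h1, h2, h3⟩ := hp
      obtain ⟨ψ₂, h4, h5, h6⟩ := hq
      refine ⟨ψ₁ + ψ₂, h1.add h4, ?_, h3.add h6⟩
      ext t
      rw [iteratedDeriv_add h1.contDiffAt h4.contDiffAt, h2, h5]
      simp
    | smul c q _ hq =>
      obtain ⟨ψ, h1, h2, h3⟩ := hq
      refine ⟨c • ψ, h1.const_smul c, ?_, h3.smul c⟩
      ext t
      rw [iteratedDeriv_const_smul_field, h2]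
      simp
  set P := Qᗮ.starProjection with hP
  -- `⟨T x, x⟩ = ‖V^k P x‖²` is the inverse Rayleigh quotient on `Qᗮ` up to normalization, so an
  -- eigenvalue `μ` of `T` produces the Wirtinger eigenvalue `μ⁻¹`.
  set T : UnitIntervalL2 →L[ℝ] UnitIntervalL2 :=
    P ∘L ((volterraAdj ^ k) ∘L ((volterra ^ k) ∘L P)) with hT
  have hTapp : ∀ x, T x = P ((volterraAdj ^ k) ((volterra ^ k) (P x))) := fun x => rfl
  have hTin : ∀ x y, inner ℝ (T x) y = inner ℝ ((volterra ^ k) (P x)) ((volterra ^ k) (P y)) := by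
    intro x y
    rw [hTapp, hP, Submodule.inner_starProjection_left_eq_right, real_inner_comm,
      ← inner_volterra_pow, real_inner_comm]
  have hg₀W : g₀ ∈ Qᗮ := by
    rw [Submodule.mem_orthogonal]
    intro u hu
    induction hu using Submodule.span_induction with
    | mem q hq =>
      obtain ⟨j, rfl⟩ := hq
      rw [hmoment j hg₀, hbd j j.2]
    | zero => simp
    | add p q _ _ hp hq => rw [inner_add_left, hp, hq, add_zero]
    | smul c q _ hq => rw [inner_smul_left, hq, mul_zero]
  have hPg₀ : P g₀ = g₀ := Submodule.starProjection_eq_self_iff.2 hg₀W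
  have hTg₀ : inner ℝ (T g₀) g₀ = ∫ s in (0:ℝ)..1, (leftPrim^[k] φ₀ s) ^ 2 := by
    rw [hTin, hPg₀, real_inner_self_eq_norm_sq, (hg₀.volterra_pow k).norm_sq_eq]
  obtain ⟨m, rfl⟩ : ∃ m, k = m + 1 := ⟨k - 1, by omega⟩
  have hcomp : IsCompactOperator T := by
    have h1 : IsCompactOperator (volterra ^ (m + 1)) := by
      rw [pow_succ]
      exact (isCompactOperator_kernelOp leftKernel).clm_comp (volterra ^ m)
    exact ((h1.comp_clm P).clm_comp (volterraAdj ^ (m + 1))).clm_comp P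
  obtain ⟨μ, hμ, ⟨g, hg0, hgμ⟩, hle⟩ := exists_eigenvector_of_isCompactOperator hcomp
    (fun x y => by
      show inner ℝ (T x) y = inner ℝ x (T y)
      rw [← real_inner_comm x (T y), hTin, hTin, real_inner_comm])
    (fun x => by rw [hTin]; exact real_inner_self_nonneg) (x₀ := g₀) (by rw [hTg₀]; exact hne)
  have hgW : g ∈ Qᗮ := by
    have h1 : μ • g ∈ Qᗮ := by rw [← hgμ]; exact Submodule.starProjection_apply_mem _ _
    have h2 := Qᗮ.smul_mem μ⁻¹ h1
    rwa [smul_smul, inv_mul_cancel₀ hμ.ne', one_smul] at h2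
  have hPg : P g = g := Submodule.starProjection_eq_self_iff.2 hgW
  have hTg : P ((volterraAdj ^ (m + 1)) ((volterra ^ (m + 1)) g)) = μ • g := by
    rw [← hgμ, hTapp, hPg]
  -- The eigenvalue equation holds only modulo `Q`, but `k` derivatives annihilate the polynomial
  -- error.
  have hq : (volterraAdj ^ (m + 1)) ((volterra ^ (m + 1)) g) - μ • g ∈ Q := by
    rw [← hTg, ← Submodule.orthogonal_orthogonal Q]
    exact Submodule.sub_starProjection_mem_orthogonal _
  obtain ⟨ψ, hψ, hψk, hψrep⟩ := hQrep _ hq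
  -- the continuous representative of `volterra ^ (m + 1) g`
  set υ : ℝ → ℝ := fun t => inner ℝ (leftKernel (Set.projIcc 0 1 zero_le_one t))
    ((volterra ^ m) g) with hυ
  have hυc : Continuous υ := by fun_prop
  have hυrep : Represents υ ((volterra ^ (m + 1)) g) := by
    rw [pow_succ', mul_apply_eq_comp]
    refine (coeFn_kernelOp leftKernel ((volterra ^ m) g)).trans
      (Filter.Eventually.of_forall fun t => ?_)
    simp only [hυ, Set.projIcc_val]
  -- Regularity bootstrap: solving the equation for `g` expresses it by a `k`-fold primitive of a
  -- continuous function and a polynomial, so `g` has a `C^k` representative.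
  set gt : ℝ → ℝ := μ⁻¹ • (rightPrim^[m + 1] υ + (-1 : ℝ) • ψ) with hgt
  have hrk : ContDiff ℝ (m + 1 : ℕ) (rightPrim^[m + 1] υ) := by
    have := contDiff_iterate_rightPrim (n := 0) (by simpa using hυc) (m + 1)
    rwa [zero_add] at this
  have hgtcd : ContDiff ℝ (m + 1 : ℕ) gt :=
    (hrk.add (hψ.const_smul (-1 : ℝ))).const_smul μ⁻¹
  have hgtc : Continuous gt := hgtcd.continuous
  have hgtrep : Represents gt g := by
    have h := ((hυrep.volterraAdj_pow (m + 1)).add (hψrep.smul (-1))).smul μ⁻¹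
    convert! h using 1
    rw [neg_one_smul, neg_sub, add_sub_cancel, smul_smul, inv_mul_cancel₀ hμ.ne', one_smul]
  have hgtk : ∀ t, iteratedDeriv (m + 1) gt t = μ⁻¹ * ((-1) ^ (m + 1) * υ t) := by
    intro t
    have hψ' : ContDiffAt ℝ (m + 1 : ℕ) ((-1 : ℝ) • ψ) t := (hψ.const_smul (-1 : ℝ)).contDiffAt
    rw [hgt, iteratedDeriv_const_smul_field, iteratedDeriv_add hrk.contDiffAt hψ', iteratedDeriv_const_smul_field, hψk,
      iteratedDeriv_iterate_rightPrim hυc]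
    simp
  set u : ℝ → ℝ := leftPrim^[m + 1] gt with hu
  have hucd : ContDiff ℝ (2 * (m + 1) : ℕ) u := by
    rw [two_mul]; exact contDiff_iterate_leftPrim hgtcd (m + 1)
  have huυ : ∀ t ∈ Set.Icc (0:ℝ) 1, υ t = u t := by
    intro t ht
    simp only [hυ, Set.projIcc_of_mem zero_le_one ht]
    rw [(hgtrep.volterra_pow m).inner_leftKernel, hu, Function.iterate_succ_apply']
  have hul : ∀ l ≤ m + 1, iteratedDeriv l u = leftPrim^[m + 1 - l] gt := by
    intro l hl
    have := iteratedDeriv_iterate_leftPrim hgtc l (m + 1 - l)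
    rwa [Nat.sub_add_cancel hl] at this
  have hwithin : ∀ l ≤ 2 * (m + 1), ∀ t ∈ Set.Icc (0:ℝ) 1,
      iteratedDerivWithin l u (Set.Icc 0 1) t = iteratedDeriv l u t := by
    intro l hl t ht
    exact iteratedDerivWithin_eq_iteratedDeriv (uniqueDiffOn_Icc one_pos)
      (hucd.contDiffAt.of_le (by exact_mod_cast hl)) ht
  refine ⟨μ⁻¹, ⟨u, hucd.contDiffOn, ?_, ?_, ?_⟩, ?_⟩
  -- If `u` vanished on `[0, 1]`, then `μ ‖g‖² = ‖V^k g‖² = 0`.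
  · by_contra hcon
    push Not at hcon
    have h1 : ‖(volterra ^ (m + 1)) g‖ ^ 2 = 0 := by
      rw [(hgtrep.volterra_pow (m + 1)).norm_sq_eq]
      have : ∀ s ∈ Set.uIcc (0:ℝ) 1, (leftPrim^[m + 1] gt s) ^ 2 = 0 := by
        intro s hs
        rw [Set.uIcc_of_le zero_le_one] at hs
        rw [← hu, hcon s hs]; simp
      rw [intervalIntegral.integral_congr this]
      simp
    have h2 : inner ℝ (T g) g = 0 := by
      rw [hTin, hPg, real_inner_self_eq_norm_sq, h1]
    rw [hgμ, real_inner_smul_left, real_inner_self_eq_norm_sq] at h2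
    have : 0 < ‖g‖ := norm_pos_iff.2 hg0
    have : 0 < μ * ‖g‖ ^ 2 := by positivity
    linarith
  · intro t ht
    rw [hwithin _ le_rfl t ht, two_mul, iteratedDeriv_eq_iterate, Function.iterate_add_apply,
      ← iteratedDeriv_eq_iterate, ← iteratedDeriv_eq_iterate, hul _ le_rfl, Nat.sub_self,
      Function.iterate_zero_apply, hgtk, huυ t ht]
    have : ((-1:ℝ) ^ (m + 1)) * (-1) ^ (m + 1) = 1 := by
      rw [← mul_pow]; simp
    linear_combination μ⁻¹ * u t * this
  · intro l hl
    have hl2 : l ≤ 2 * (m + 1) := by omega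
    rw [hwithin l hl2 0 (by simp), hwithin l hl2 1 (by simp), hul l hl.le]
    -- At least one primitive remains: it vanishes at `0` by construction, and at `1` because `g ∈
    -- Qᗮ`.
    obtain ⟨j, hj⟩ : ∃ j, m + 1 - l = j + 1 := ⟨m - l, by omega⟩
    rw [hj]
    refine ⟨?_, ?_⟩
    · rw [Function.iterate_succ_apply', leftPrim, intervalIntegral.integral_same]
    · rw [← hmoment j hgtrep]
      exact (Submodule.mem_orthogonal _ _).1 hgW _
        (Submodule.subset_span ⟨⟨j, by omega⟩, rfl⟩)
  · rw [hTg₀, hg₀.norm_sq_eq] at hle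
    rw [inv_mul_le_iff₀ hμ]
    exact hle

/-- The eigenvalues are nonnegative. -/
theorem IsWirtingerEigenvalue.nonneg {r : ℕ} {lam : ℝ} (h : IsWirtingerEigenvalue r lam) :
    0 ≤ lam := by
  obtain ⟨u, hu, ⟨t₀, ht₀, hne⟩, heq, hbd⟩ := h
  set D : ℕ → ℝ → ℝ := fun l => iteratedDerivWithin l u (Set.Icc 0 1) with hD
  have huniq : UniqueDiffOn ℝ (Set.Icc (0:ℝ) 1) := uniqueDiffOn_Icc one_pos
  have hcont : ∀ l ≤ 2 * r, ContinuousOn (D l) (Set.Icc 0 1) := fun l hl =>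
    hu.continuousOn_iteratedDerivWithin (by exact_mod_cast hl) huniq
  have hder : ∀ l < 2 * r, ∀ t ∈ Set.Icc (0:ℝ) 1,
      HasDerivWithinAt (D l) (D (l + 1) t) (Set.Icc 0 1) t := by
    intro l hl t ht
    have := (hu.differentiableOn_iteratedDerivWithin (m := l) (by exact_mod_cast hl) huniq t
      ht).hasDerivWithinAt
    rwa [← iteratedDerivWithin_succ] at this
  have hI : Set.uIcc (0:ℝ) 1 = Set.Icc 0 1 := Set.uIcc_of_le zero_le_one
  have hint : ∀ l ≤ 2 * r, IntervalIntegrable (D l) volume 0 1 := fun l hl =>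
    (by rw [hI]; exact hcont l hl : ContinuousOn (D l) (Set.uIcc 0 1)).intervalIntegrable
  -- Boundary terms vanish as long as `j < r`; at `j = r` this yields `lam ∫ u² = ∫ (u^(r))²`.
  have hparts : ∀ j ≤ r, ∫ t in (0:ℝ)..1, D 0 t * D (2 * r) t =
      (-1) ^ j * ∫ t in (0:ℝ)..1, D j t * D (2 * r - j) t := by
    intro j hj
    induction j with
    | zero => simp
    | succ j ih =>
      rw [ih (by omega)]
      obtain ⟨n, hn⟩ : ∃ n, 2 * r - j = n + 1 := ⟨2 * r - j - 1, by omega⟩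
      have hn' : 2 * r - (j + 1) = n := by omega
      rw [hn, hn']
      have hp := intervalIntegral.integral_mul_deriv_eq_deriv_mul_of_hasDerivWithinAt
        (a := 0) (b := 1) (u := D j) (v := D n) (u' := D (j + 1)) (v' := D (n + 1))
        (by rw [hI]; exact hder j (by omega)) (by rw [hI]; exact hder n (by omega))
        (hint _ (by omega)) (hint _ (by omega))
      have hb : D j 0 = 0 ∧ D j 1 = 0 := hbd j (by omega)
      rw [hp, hb.1, hb.2, pow_succ]
      ring
  have h1 := hparts r le_rfl
  rw [show 2 * r - r = r by omega] at h1
  have h2 : lam * ∫ t in (0:ℝ)..1, u t ^ 2 = ∫ t in (0:ℝ)..1, D r t * D r t := by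
    have e : ∀ t ∈ Set.uIcc (0:ℝ) 1, lam * u t ^ 2 = (-1) ^ r * (D 0 t * D (2 * r) t) := by
      intro t ht
      rw [hI] at ht
      have := heq t ht
      simp only [hD, iteratedDerivWithin_zero]
      linear_combination -u t * this
    rw [← intervalIntegral.integral_const_mul, intervalIntegral.integral_congr e,
      intervalIntegral.integral_const_mul, h1, ← mul_assoc, ← mul_pow]
    simp
  have h3 : 0 < ∫ t in (0:ℝ)..1, u t ^ 2 :=
    intervalIntegral.integral_pos one_pos (hu.continuousOn.pow 2) (fun t _ => by positivity)
      ⟨t₀, ht₀, by positivity⟩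
  have h4 : 0 ≤ ∫ t in (0:ℝ)..1, D r t * D r t :=
    intervalIntegral.integral_nonneg zero_le_one fun t _ => mul_self_nonneg _
  rw [← h2] at h4
  exact nonneg_of_mul_nonneg_left h4 h3

/-! ### The comparison function `sin (π t) ^ k`. -/

theorem integral_exp_two_pi_int {n : ℤ} (hn : n ≠ 0) :
    ∫ t in (0:ℝ)..1, Complex.exp (2 * Real.pi * Complex.I * n * t) = 0 := by
  have hc : (2 * Real.pi * Complex.I * n : ℂ) ≠ 0 := by
    simp [Real.pi_ne_zero, hn]
  rw [integral_exp_mul_complex hc]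
  have : Complex.exp (2 * Real.pi * Complex.I * n * (1:ℝ)) = 1 :=
    Complex.exp_eq_one_iff.2 ⟨n, by push_cast; ring⟩
  rw [this]
  simp

/-- Parseval's identity for trigonometric polynomials with frequencies in `(c + 2 ℤ) / 2`. -/
theorem integral_norm_sq_trig_sum (N : ℕ) (c : ℝ) (b : ℕ → ℂ) :
    ∫ t in (0:ℝ)..1, ‖∑ m ∈ Finset.range N,
      b m * Complex.exp (Real.pi * Complex.I * (c - 2 * m) * t)‖ ^ 2 =
      ∑ m ∈ Finset.range N, ‖b m‖ ^ 2 := by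
  have hexp : ∀ t : ℝ, ((‖∑ m ∈ Finset.range N,
      b m * Complex.exp (Real.pi * Complex.I * (c - 2 * m) * t)‖ ^ 2 : ℝ) : ℂ) =
      ∑ m ∈ Finset.range N, ∑ n ∈ Finset.range N, b m * (starRingEnd ℂ) (b n) *
        Complex.exp (2 * Real.pi * Complex.I * ((n - m : ℤ) : ℂ) * t) := by
    intro t
    rw [Complex.ofReal_pow, ← Complex.mul_conj', map_sum, Finset.sum_mul_sum]
    refine Finset.sum_congr rfl fun m _ => Finset.sum_congr rfl fun n _ => ?_
    rw [map_mul, ← Complex.exp_conj]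
    simp only [map_mul, map_sub, Complex.conj_ofReal, Complex.conj_I, map_natCast, map_ofNat]
    have : Complex.exp (2 * Real.pi * Complex.I * ((n - m : ℤ) : ℂ) * t) =
        Complex.exp (Real.pi * Complex.I * (c - 2 * m) * t) *
          Complex.exp (Real.pi * -Complex.I * (c - 2 * n) * t) := by
      rw [← Complex.exp_add]
      congr 1
      push_cast
      ring
    rw [this]
    ring
  apply Complex.ofReal_injective
  rw [← intervalIntegral.integral_ofReal]
  simp only [hexp]
  have hii : ∀ m n : ℕ, IntervalIntegrable (fun t : ℝ => b m * (starRingEnd ℂ) (b n) *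
      Complex.exp (2 * Real.pi * Complex.I * ((n - m : ℤ) : ℂ) * t)) volume 0 1 := fun m n =>
    Continuous.intervalIntegrable (by fun_prop) _ _
  rw [intervalIntegral.integral_finsetSum fun m _ =>
    Continuous.intervalIntegrable (by fun_prop) _ _]
  rw [Complex.ofReal_sum]
  refine Finset.sum_congr rfl fun m hm => ?_
  rw [intervalIntegral.integral_finsetSum fun n _ => hii m n, Finset.sum_eq_single m]
  · simp [Complex.mul_conj']
  · intro n _ hnm
    rw [intervalIntegral.integral_const_mul, integral_exp_two_pi_int (by omega), mul_zero]
  · exact fun h => absurd hm h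

/-- Euler's formula and the binomial theorem. The frequencies `π (k - 2 m)` differ by multiples of
`2 π`, hence are orthogonal on `[0, 1]`, and lie in `[-k π, k π]`. -/
theorem sin_pow_eq_trig_sum (k : ℕ) : ∃ a : ℕ → ℂ, ∀ z : ℂ, Complex.sin (Real.pi * z) ^ k =
    ∑ m ∈ Finset.range (k + 1), a m * Complex.exp (Real.pi * Complex.I * ((k:ℝ) - 2 * m) * z) := by
  refine ⟨fun m => (Complex.I / 2) ^ m * (-(Complex.I / 2)) ^ (k - m) * (k.choose m : ℂ),
    fun z => ?_⟩
  have hs : Complex.sin (Real.pi * z) = Complex.I / 2 * Complex.exp (-(Real.pi * z) * Complex.I) +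
      -(Complex.I / 2) * Complex.exp (Real.pi * z * Complex.I) := by
    rw [Complex.sin]; ring
  rw [hs, add_pow]
  refine Finset.sum_congr rfl fun m hm => ?_
  rw [mul_pow, mul_pow, ← Complex.exp_nat_mul, ← Complex.exp_nat_mul]
  have hmk : m ≤ k := Nat.lt_succ_iff.1 (Finset.mem_range.1 hm)
  have : Complex.exp (Real.pi * Complex.I * ((k:ℝ) - 2 * m) * z) =
      Complex.exp (m * (-(Real.pi * z) * Complex.I)) *
        Complex.exp ((k - m : ℕ) * (Real.pi * z * Complex.I)) := by
    rw [← Complex.exp_add, Nat.cast_sub hmk]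
    congr 1
    push_cast
    ring
  rw [this]
  ring

theorem iteratedDeriv_trig_sum (N n : ℕ) (a c : ℕ → ℂ) (z : ℂ) :
    iteratedDeriv n (fun z : ℂ => ∑ m ∈ Finset.range N, a m * Complex.exp (c m * z)) z =
      ∑ m ∈ Finset.range N, (a m * c m ^ n) * Complex.exp (c m * z) := by
  rw [iteratedDeriv_fun_sum fun m _ => ContDiff.contDiffAt (by fun_prop)]
  refine Finset.sum_congr rfl fun m _ => ?_
  rw [iteratedDeriv_const_mul_field, iteratedDeriv_cexp_const_mul]
  ring

/-- Iterated derivatives of a real function that extends to an entire function. -/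
theorem ofReal_iteratedDeriv_eq {s : ℝ → ℝ} {S : ℂ → ℂ} (hs : ContDiff ℝ ∞ s)
    (hS : Differentiable ℂ S) (h : ∀ t : ℝ, (s t : ℂ) = S t) (n : ℕ) (t : ℝ) :
    ((iteratedDeriv n s t : ℝ) : ℂ) = iteratedDeriv n S t := by
  induction n generalizing t with
  | zero => simpa using h t
  | succ n ih =>
    rw [iteratedDeriv_succ, iteratedDeriv_succ]
    have h1 := (hs.differentiable_iteratedDeriv n
      (by exact_mod_cast ENat.natCast_lt_top n) t).hasDerivAt.ofReal_comp
    have h2 := ((hS.differentiable_iteratedDeriv_complex n) (t : ℂ)).hasDerivAt.comp_ofReal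
    rw [funext ih] at h1
    exact h1.unique h2

/-- The zero jet at `0` removes all constants of integration; this puts `s` in the form `V^k φ₀`
that the Rayleigh bound expects. -/
theorem iterate_leftPrim_iteratedDeriv {s : ℝ → ℝ} (hs : ContDiff ℝ ∞ s) {k : ℕ}
    (h0 : ∀ l < k, iteratedDeriv l s 0 = 0) {j : ℕ} (hj : j ≤ k) :
    leftPrim^[j] (iteratedDeriv k s) = iteratedDeriv (k - j) s := by
  induction j with
  | zero => simp
  | succ j ih =>
    rw [Function.iterate_succ_apply', ih (by omega)]
    obtain ⟨n, hn⟩ : ∃ n, k - j = n + 1 := ⟨k - j - 1, by omega⟩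
    have hn' : k - (j + 1) = n := by omega
    rw [hn, hn', iteratedDeriv_succ]
    ext t
    have hd : Differentiable ℝ (iteratedDeriv n s) :=
      hs.differentiable_iteratedDeriv n (by exact_mod_cast ENat.natCast_lt_top n)
    have hc : Continuous (deriv (iteratedDeriv n s)) := by
      rw [← iteratedDeriv_succ]
      exact hs.continuous_iteratedDeriv _ (by exact_mod_cast le_top)
    rw [leftPrim, intervalIntegral.integral_deriv_eq_sub (fun x _ => hd x)
      (hc.intervalIntegrable _ _), h0 n (by omega), sub_zero]

/-- Some eigenvalue is at most `(k π) ^ (2 k)`; the comparison function is `sin (π t) ^ k`. -/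
theorem exists_isWirtingerEigenvalue_le {k : ℕ} (hk : 1 ≤ k) :
    ∃ lam : ℝ, IsWirtingerEigenvalue k lam ∧ lam ≤ (k * Real.pi) ^ (2 * k) := by
  set s : ℝ → ℝ := fun t => Real.sin (Real.pi * t) ^ k with hs
  set S : ℂ → ℂ := fun z => Complex.sin (Real.pi * z) ^ k with hS
  have hscd : ContDiff ℝ ∞ s := by fun_prop
  have hSd : Differentiable ℂ S := by fun_prop
  have hsS : ∀ t : ℝ, (s t : ℂ) = S t := fun t => by simp [hs, hS]
  have hder := ofReal_iteratedDeriv_eq hscd hSd hsS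
  -- Read off from the analytic order, which is multiplicative under powers, after passing to the
  -- complex sine.
  have hvan : ∀ t : ℝ, Real.sin (Real.pi * t) = 0 → ∀ l < k, iteratedDeriv l s t = 0 := by
    intro t ht l hl
    have han : AnalyticAt ℂ (fun z : ℂ => Complex.sin (Real.pi * z)) (t : ℂ) := by fun_prop
    have h0 : Complex.sin (Real.pi * (t : ℂ)) = 0 := by
      rw [← Complex.ofReal_mul, ← Complex.ofReal_sin, ht, Complex.ofReal_zero]
    have h1 : 1 ≤ analyticOrderAt (fun z : ℂ => Complex.sin (Real.pi * z)) (t : ℂ) := by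
      rw [Order.one_le_iff_ne_zero]
      exact han.analyticOrderAt_ne_zero.2 h0
    have h2 : (k : ℕ∞) ≤ analyticOrderAt S (t : ℂ) := by
      have := analyticOrderAt_pow han k
      change analyticOrderAt S (t : ℂ) = _ at this
      rw [this, nsmul_eq_mul]
      exact le_mul_of_one_le_right zero_le h1
    have h3 := (natCast_le_analyticOrderAt_iff_iteratedDeriv_eq_zero
      (hSd.analyticAt (t : ℂ))).1 h2 l hl
    rw [← hder] at h3
    exact_mod_cast h3
  have hv0 := hvan 0 (by simp)
  have hv1 := hvan 1 (by simp)
  have hprim := fun j (hj : j ≤ k) => iterate_leftPrim_iteratedDeriv hscd hv0 hj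
  have hprimk : leftPrim^[k] (iteratedDeriv k s) = s := by
    rw [hprim k le_rfl, Nat.sub_self, iteratedDeriv_zero]
  have hpos : 0 < ∫ t in (0:ℝ)..1, s t ^ 2 := by
    refine intervalIntegral.integral_pos one_pos (hscd.continuous.pow 2).continuousOn
      (fun t _ => by positivity) ⟨1 / 2, by norm_num, ?_⟩
    have : Real.pi * (1 / 2) = Real.pi / 2 := by ring
    simp only [hs, this, Real.sin_pi_div_two]
    norm_num
  obtain ⟨lam, hlam, hle⟩ := exists_isWirtingerEigenvalue_mul_le hk
    (φ₀ := iteratedDeriv k s) (hscd.continuous_iteratedDeriv k (by exact_mod_cast le_top))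
    (fun j hj => by rw [hprim (j + 1) hj]; exact hv1 _ (by omega))
    (by rw [hprimk]; exact hpos)
  rw [hprimk] at hle
  refine ⟨lam, hlam, ?_⟩
  obtain ⟨a, ha⟩ := sin_pow_eq_trig_sum k
  have hSeq : S = fun z => ∑ m ∈ Finset.range (k + 1),
      a m * Complex.exp (Real.pi * Complex.I * ((k:ℝ) - 2 * m) * z) := funext ha
  have hsq : ∀ n, ∫ t in (0:ℝ)..1, iteratedDeriv n s t ^ 2 = ∑ m ∈ Finset.range (k + 1),
      ‖a m * (Real.pi * Complex.I * ((k:ℝ) - 2 * m)) ^ n‖ ^ 2 := by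
    intro n
    rw [← integral_norm_sq_trig_sum (k + 1) k]
    refine intervalIntegral.integral_congr fun t _ => ?_
    rw [← iteratedDeriv_trig_sum (k + 1) n a
      (fun m => Real.pi * Complex.I * ((k:ℝ) - 2 * m)), ← hSeq, ← hder, Complex.norm_real,
      Real.norm_eq_abs, sq_abs]
  -- By Parseval, `k` derivatives multiply each coefficient by at most `(k π)^k` in modulus.
  have hbern : ∫ t in (0:ℝ)..1, iteratedDeriv k s t ^ 2 ≤
      (k * Real.pi) ^ (2 * k) * ∫ t in (0:ℝ)..1, s t ^ 2 := by
    have h0 := hsq 0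
    simp only [iteratedDeriv_zero, pow_zero, mul_one] at h0
    rw [hsq k, h0, Finset.mul_sum]
    refine Finset.sum_le_sum fun m hm => ?_
    have hmk : (m : ℝ) ≤ k := by exact_mod_cast Nat.lt_succ_iff.1 (Finset.mem_range.1 hm)
    have h1 : ‖(Real.pi * Complex.I * ((k:ℝ) - 2 * m) : ℂ)‖ ≤ k * Real.pi := by
      have : (((k:ℝ) : ℂ) - 2 * m) = (((k:ℝ) - 2 * m : ℝ) : ℂ) := by push_cast; rfl
      rw [this, norm_mul, norm_mul, Complex.norm_I, Complex.norm_real, Complex.norm_real,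
        Real.norm_of_nonneg Real.pi_pos.le, mul_one, mul_comm, Real.norm_eq_abs]
      gcongr
      have : (0:ℝ) ≤ m := by positivity
      rw [abs_le]
      constructor <;> linarith
    rw [norm_mul, norm_pow, mul_pow, ← pow_mul, mul_comm k 2, mul_comm]
    gcongr
  exact le_of_mul_le_mul_right (hle.trans hbern) hpos

/-! ### The bound on `c_k` and the conclusion. -/

theorem wirtingerConst_nonneg (k : ℕ) : 0 ≤ wirtingerConst k :=
  Real.sInf_nonneg fun _ h => IsWirtingerEigenvalue.nonneg h

/-- Nonnegativity of the eigenvalues makes the infimum a genuine lower bound, so one eigenvalue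
below `(k π)^(2k)` is enough. -/
theorem wirtingerConst_rpow_le {k : ℕ} (hk : 1 ≤ k) :
    wirtingerConst k ^ (1 / (2 * (k : ℝ))) ≤ k * Real.pi := by
  obtain ⟨lam, hlam, hle⟩ := exists_isWirtingerEigenvalue_le hk
  have h1 : wirtingerConst k ≤ (k * Real.pi) ^ (2 * k) :=
    (csInf_le ⟨0, fun _ h => IsWirtingerEigenvalue.nonneg h⟩ hlam).trans hle
  have hkπ : 0 ≤ k * Real.pi := by positivity
  have hk0 : (k : ℝ) ≠ 0 := by exact_mod_cast (by omega : k ≠ 0)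
  refine (Real.rpow_le_rpow (wirtingerConst_nonneg k) h1 (by positivity)).trans (le_of_eq ?_)
  rw [← Real.rpow_natCast, ← Real.rpow_mul hkπ]
  have : ((2 * k : ℕ) : ℝ) * (1 / (2 * (k : ℝ))) = 1 := by
    push_cast; field_simp
  rw [this, Real.rpow_one]

theorem theorem3p3 (k : ℕ) (hk : 1 ≤ k) (σ : ℝ) (hσ : 0 < σ)
    (x : ℤ → ℝ) (hx : StrictMono x) (γ : ℝ) (hγ : 0 < γ) (hsep : SeparatedBy x γ)
    (ν : ℕ) (hν : 1 ≤ ν) (δ : ℝ)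
    (hδ : IsLUB (Set.range fun i : ℤ => x (i + (ν : ℤ)) - x i) δ)
    (hlt : δ < (ν : ℝ) / σ * wirtingerConst k ^ (1 / (2 * (k : ℝ)))) :
    ∃ A B : ℝ, 0 < A ∧ 0 < B ∧
      ∀ f ∈ Bandlimited σ,
        -- `F` is the smooth (hence unique continuous) representative of the class `f`
        ∃ F : ℝ → ℂ, ContDiff ℝ ∞ F ∧ F =ᵐ[volume] f ∧
          Summable (fun i : ℤ => ∑ l ∈ Finset.range k, ‖iteratedDeriv l F (x i)‖ ^ 2) ∧
          A * ‖f‖ ^ 2 ≤ ∑' i : ℤ, ∑ l ∈ Finset.range k, ‖iteratedDeriv l F (x i)‖ ^ 2 ∧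
          ∑' i : ℤ, ∑ l ∈ Finset.range k, ‖iteratedDeriv l F (x i)‖ ^ 2 ≤ B * ‖f‖ ^ 2 := by
  have hνpos : (0:ℝ) < ν := by exact_mod_cast hν
  refine sampling_with_derivatives_of_density hk hσ hx hγ hsep hν (fun i => hδ.1 ⟨i, rfl⟩) ?_
  have h1 : δ < (ν : ℝ) / σ * (k * Real.pi) :=
    hlt.trans_le (mul_le_mul_of_nonneg_left (wirtingerConst_rpow_le hk) (by positivity))
  calc σ * (δ / ν) < σ * (ν / σ * (k * Real.pi) / ν) := by gcongr
    _ = k * Real.pi := by field_simp
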